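/- Setting. Choose Cartesian coordinates in $\mathbb R^3$ whose third axis is the view direction, pointing to the viewer; let $\pi(x,y,z)=(x,y)$ be the axonometric (orthographic) projection onto the canvas $\mathbb R^2$. Let $S=f(D)$ be a surface, where $D\subset\mathbb R^2$ has a boundary that, apart from finitely many corners, is locally a regular $C^1$ curve with $D$ on one side, and $f:\mathbb R^2\to\mathbb R^3$ is $C^2$ with injective differential on $D$. Let $g=\pi\circ f$ and $R=g(D)$. The front side of $S$ is the side of the normal $\partial_1 f\times\partial_2 f$; the front (back) side faces the canvas at a point if the third component of this normal is positive (negative) there. A point of $S$ is visible if no point of $S$ with the same projection is nearer to the viewer, and occluded otherwise. Visible (occluded) boundary lines are the projections of pieces of $f(\partial D)$ consisting of visible (occluded) points; the contour lines form the set $\partial R\setminus g(\partial D)$. Together these are the structural lines; a minimal region is a connected component of $R$ minus all structural lines. The contour generator $K$ is the set of interior points of $D$ at which the view direction is tangent to $S$. All contours are drawn in the sketch: $g(K)$ is contained in the union of the structural lines. Two minimal regions share a visible (occluded) boundary line if a nonempty relatively open piece of $\partial D$, consisting of visible (occluded) points, is projected into the boundary of both regions. Assume: (1) $D$ is homeomorphic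 to a closed disk and $f$ is injective on $D$; (2) $R$ is homeomorphic to a closed disk; (3) every line parallel to the view direction meets $S$ in at most two points; (4) if some occluded point of $S$ projects into a minimal region, then the boundary of that region meets a contour line; (5) structural lines overlap only at isolated points: the set of points of the canvas that are the projections of two different points of $\partial D\cup K$ consists of isolated points; (6) the projected area of the visible points where the front side faces the canvas is larger than that of the visible points where the back side does. Then for any two distinct minimal regions $M_1\neq M_2$, where the visible part of $M_i$ is the set of visible points of $S$ that project into $M_i$: (a) If $M_1$ and $M_2$ share a visible boundary line, their visible parts have opposite orientations: the front side faces the canvas at every point of one of the two visible parts, and the back side at every point of the other. (b) If $M_1$ and $M_2$ share an occluded boundary line, their visible parts have the same orientation: either the front side faces the canvas at every point of both visible parts, or the back side does. -/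

import Mathlib

open Set Topology MeasureTheory
open scoped Matrix

/-- The canvas, and also the plane in which parameter domains live. -/
abbrev Plane : Type := EuclideanSpace ℝ (Fin 2)

/-- Three-space, with Cartesian coordinates adapted to the view: the third axis is the view
direction and points from the surface to the viewer, the first two span the canvas. -/
abbrev Space : Type := EuclideanSpace ℝ (Fin 3)

/-- The axonometric (orthographic) projection of space onto the canvas. -/
noncomputable def toCanvas (P : Space) : Plane := !₂[P 0, P 1]

/-- Height above the canvas plane; larger means nearer to the viewer. -/
def height (P : Space) : ℝ := P 2

/-- A regularly parametrized oriented `C²` surface patch with piecewise `C¹` boundary.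
The parametrization is a map of the whole plane, but only its values on `dom` matter. Its
front side is the one given by the parametrization. Disk topology and injectivity are not
part of this definition. -/
structure Surface where
  /-- the parameter domain -/
  dom : Set Plane
  /-- the parametrization -/
  f : Plane → Space
  contDiff : ContDiff ℝ 2 f
  immersion : ∀ x ∈ dom, Function.Injective (fderiv ℝ f x)
  /-- apart from finitely many corners, the domain is locally one side of a regular curve -/
  piecewise_boundary : ∃ corners : Set Plane, corners.Finite ∧
    ∀ b ∈ frontier dom \ corners, ∃ (N : Set Plane) (ρ : Plane → ℝ),
      IsOpen N ∧ b ∈ N ∧ ContDiff ℝ 1 ρ ∧ fderiv ℝ ρ b ≠ 0 ∧ dom ∩ N = {x ∈ N | ρ x ≤ 0}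

namespace Surface

variable (S : Surface)

/-- The surface as a set of points of space. -/
def points : Set Space := S.f '' S.dom

/-- The point of the canvas onto which the surface point with parameter `x` is projected. -/
noncomputable def proj (x : Plane) : Plane := toCanvas (S.f x)

/-- The area on the canvas that the surface projects onto. -/
noncomputable def area : Set Plane := S.proj '' S.dom

/-- The normal `∂₁f × ∂₂f`, which points to the front side of the surface. -/
noncomputable def normal (x : Plane) : Fin 3 → ℝ :=
  (WithLp.ofLp (fderiv ℝ S.f x (EuclideanSpace.single 0 1))) ⨯₃
    (WithLp.ofLp (fderiv ℝ S.f x (EuclideanSpace.single 1 1)))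

/-- Component of the normal along the view direction: positive where the front side faces the
canvas, negative where the back side does, zero where the view direction is tangent. -/
noncomputable def facing (x : Plane) : ℝ := S.normal x 2

/-- The surface point with parameter `x` is visible: no point of the surface on the same line
parallel to the view direction is nearer to the viewer. -/
def Visible (x : Plane) : Prop :=
  ∀ y ∈ S.dom, S.proj y = S.proj x → height (S.f y) ≤ height (S.f x)

/-- Parameters of the surface boundary. -/
def bdry : Set Plane := frontier S.dom

/-- Parameters of the visible, respectively occluded, part of the surface boundary. -/
def visibleBdry : Set Plane := {x ∈ S.bdry | S.Visible x}

def occludedBdry : Set Plane := {x ∈ S.bdry | ¬ S.Visible x}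

/-- The contour lines: the part of the boundary of the surface area on the canvas that does not
come from the surface boundary. -/
noncomputable def contourLines : Set Plane := frontier S.area \ S.proj '' S.bdry

/-- All structural lines: visible boundaries, occluded boundaries and contour lines. -/
noncomputable def structuralLines : Set Plane :=
  S.proj '' S.visibleBdry ∪ S.proj '' S.occludedBdry ∪ S.contourLines

/-- A minimal region: a connected component of what the structural lines leave of the area. -/
def IsMinimalRegion (M : Set Plane) : Prop :=
  ∃ p ∈ S.area \ S.structuralLines, M = connectedComponentIn (S.area \ S.structuralLines) p

/-- The visible part of the surface over a region of the canvas. -/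
def visiblePart (M : Set Plane) : Set Plane := {x ∈ S.dom | S.proj x ∈ M ∧ S.Visible x}

/-- The occluded part of the surface over a region of the canvas. -/
def occludedPart (M : Set Plane) : Set Plane := {x ∈ S.dom | S.proj x ∈ M ∧ ¬ S.Visible x}

/-- The contour generator: the points off the surface boundary where the view direction is
tangent to the surface. -/
def contourGenerator : Set Plane := {x ∈ interior S.dom | S.facing x = 0}

/-- The sketch shows every contour of the surface: the view direction is tangent to the surface,
off its boundary, only at points that lie on a structural line of the sketch. -/
def ContoursDrawn : Prop := ∀ x ∈ S.contourGenerator, S.proj x ∈ S.structuralLines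

/-- The points of the canvas where structural lines overlap, that is, onto which two different
points of the surface boundary and the contour generator are projected. -/
def overlaps : Set Plane :=
  {p | ∃ x ∈ S.bdry ∪ S.contourGenerator, ∃ y ∈ S.bdry ∪ S.contourGenerator,
    x ≠ y ∧ S.proj x = p ∧ S.proj y = p}

/-- The standing assumptions on the surface and its sketch. -/
structure SketchAssumption : Prop where
  /-- the surface is of disk topology -/
  disk : Nonempty (S.dom ≃ₜ Metric.closedBall (0 : Plane) 1)
  /-- and has no self-intersection -/
  no_self_intersection : InjOn S.f S.dom
  /-- it projects onto a region of disk topology -/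
  disk_area : Nonempty (S.area ≃ₜ Metric.closedBall (0 : Plane) 1)
  /-- a line parallel to the view direction meets it in at most two points -/
  two_points : ∀ p : Plane, {P ∈ S.points | toCanvas P = p}.encard ≤ 2
  /-- a minimal region with an occluded part has a contour line among its enclosing lines -/
  contour_of_occluded : ∀ M, S.IsMinimalRegion M → (S.occludedPart M).Nonempty →
    (frontier M ∩ S.contourLines).Nonempty
  /-- structural lines overlap only at isolated points -/
  isolated_overlaps : ∀ p ∈ S.overlaps, ∃ U : Set Plane, IsOpen U ∧ U ∩ S.overlaps = {p}
  /-- the visible parts facing the canvas with their front have the larger total area -/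
  front_larger :
    volume (S.proj '' {x ∈ S.visiblePart univ | S.facing x < 0}) <
      volume (S.proj '' {x ∈ S.visiblePart univ | 0 < S.facing x})

/-- Two regions share a line that is the projection of a part of `A`, for a set `A` of boundary
parameters: some nonempty relatively open piece of the surface boundary lies in `A` and is
projected into the frontier of both regions. -/
def ShareLine (A M₁ M₂ : Set Plane) : Prop :=
  ∃ W : Set Plane, IsOpen W ∧ (W ∩ S.bdry).Nonempty ∧ W ∩ S.bdry ⊆ A ∧
    S.proj '' (W ∩ S.bdry) ⊆ frontier M₁ ∩ frontier M₂

/-- The visible part over `M` faces the canvas with its front side. -/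
def VisibleFront (M : Set Plane) : Prop := ∀ x ∈ S.visiblePart M, 0 < S.facing x

/-- The visible part over `M` faces the canvas with its back side. -/
def VisibleBack (M : Set Plane) : Prop := ∀ x ∈ S.visiblePart M, S.facing x < 0

/-- The visible parts over the two regions have the same orientation. -/
def SameOrientation (M₁ M₂ : Set Plane) : Prop :=
  (S.VisibleFront M₁ ∧ S.VisibleFront M₂) ∨ (S.VisibleBack M₁ ∧ S.VisibleBack M₂)

/-- The visible parts over the two regions have opposite orientations. -/
def OppositeOrientation (M₁ M₂ : Set Plane) : Prop :=
  (S.VisibleFront M₁ ∧ S.VisibleBack M₂) ∨ (S.VisibleBack M₁ ∧ S.VisibleFront M₂)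

end Surface

/-! Write `g` for `S.proj`. Since all contours are drawn, every surface point over a minimal region
is an interior point of `D` at which `g` is a local diffeomorphism. As `D` is compact and fibres
have at most two points, both the number of sheets and the side shown by the visible sheet are
constant over a region (`IsMinimalRegion.exists_ne_preimage`, `IsMinimalRegion.facing_mul_pos`).

Where a region has two sheets, they show different sides (`IsMinimalRegion.opposite_facing`). Its
frontier contains a contour point outside the overlaps, whose only preimage is interior to `D`. Near
that preimage the two sheets meet along a level curve of one coordinate of `g`; if both showed the
same side, the other coordinate would take its common value a third time on this curve
(`exists_fold_nhds`).

Occluded line: at a boundary point outside the overlaps, the point in front lies on a regular sheet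
that continues across the line and stays visible, so both regions show the same side.

Visible line: in a chart at the boundary, the surface near the boundary leaves the projected
boundary curve towards one side, called below. If nothing else lay over the curve, two distinct
regions along it could only arise from a vertical line of the chart crossing the boundary value
again, which itself yields a second preimage (`BoundaryChart.exists_other_preimage`). Hence a
regular sheet lies behind some point of the curve and covers both sides. Above, this sheet is the
visible one; below, it is hidden by the boundary sheet, which shows the opposite side
(`BoundaryChart.SubBox.oppositeOrientation`). -/

open Filter

/-- `toCanvas` as a continuous linear map. -/
noncomputable def toCanvasL : Space →L[ℝ] Plane :=
  LinearMap.toContinuousLinearMap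
    { toFun := toCanvas
      map_add' := fun P Q => by ext i; fin_cases i <;> simp [toCanvas]
      map_smul' := fun c P => by ext i; fin_cases i <;> simp [toCanvas] }

lemma toCanvasL_apply (P : Space) : toCanvasL P = toCanvas P := rfl

/-! ### Compactness and connectedness in the plane -/

/-- A preimage under a map that is continuous on a compact set can only be found near the
preimages of a nearby point. -/
lemma IsCompact.eventually_forall_preimage {X Y : Type*} [TopologicalSpace X]
    [TopologicalSpace Y] [T2Space Y] {D : Set X} (hD : IsCompact D) {g : X → Y}
    (hg : Continuous g) {p : Y} {Φ : X → Prop}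
    (h : ∀ x ∈ D, g x = p → ∀ᶠ y in 𝓝 x, Φ y) :
    ∀ᶠ p' in 𝓝 p, ∀ x ∈ D, g x = p' → Φ x := by
  have hC : IsCompact (D \ interior {x | Φ x}) := hD.diff isOpen_interior
  have hcl : IsClosed (g '' (D \ interior {x | Φ x})) := (hC.image hg).isClosed
  have hp : p ∈ (g '' (D \ interior {x | Φ x}))ᶜ := by
    rintro ⟨x, ⟨hx, hx'⟩, rfl⟩
    exact hx' (mem_interior_iff_mem_nhds.2 (h x hx rfl))
  filter_upwards [hcl.isOpen_compl.mem_nhds hp] with p' hp' x hx hxp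
  by_contra hΦ
  exact hp' ⟨x, ⟨hx, fun hi => hΦ (interior_subset (s := {x | Φ x}) hi)⟩, hxp⟩

/-- Dimension two enters here: a point does not separate a disk. Combined with the next lemma, this
produces frontier points different from a given one. -/
lemma Plane.ball_diff_singleton_isPreconnected (p : Plane) (r : ℝ) :
    IsPreconnected (Metric.ball p r \ {p}) := by
  rcases le_or_gt r 0 with hr | hr
  · simp [Metric.ball_eq_empty.2 hr, isPreconnected_empty]
  have h0 : IsPreconnected ({0}ᶜ : Set Plane) :=
    (isConnected_compl_singleton_of_one_lt_rank
      (by rw [← Module.finrank_eq_rank]; simp) 0).isPreconnected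
  have himage : OpenPartialHomeomorph.univBall p r '' {0}ᶜ = Metric.ball p r \ {p} := by
    have hinj : InjOn (OpenPartialHomeomorph.univBall p r) univ := by
      simpa using (OpenPartialHomeomorph.univBall p r).injOn
    rw [compl_eq_univ_sdiff, hinj.image_sdiff, univ_inter, image_singleton,
      OpenPartialHomeomorph.univBall_apply_zero, ← OpenPartialHomeomorph.univBall_source p r,
      OpenPartialHomeomorph.image_source_eq_target, OpenPartialHomeomorph.univBall_target p hr]
  rw [← himage]
  exact h0.image _ (OpenPartialHomeomorph.continuous_univBall p r).continuousOn

lemma IsPreconnected.inter_frontier_nonempty_of_inter_compl {X : Type*} [TopologicalSpace X]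
    {s t : Set X} (hs : IsPreconnected s) (h1 : (s ∩ t).Nonempty) (h2 : (s ∩ tᶜ).Nonempty) :
    (s ∩ frontier t).Nonempty := by
  by_contra h
  have hmem : ∀ x ∈ s, x ∈ interior t ∨ x ∈ (closure t)ᶜ := fun x hx => by
    by_contra! hx'
    exact h ⟨x, hx, not_not.1 hx'.2, hx'.1⟩
  obtain ⟨x, hx, hxt⟩ := h1
  obtain ⟨y, hy, hyt⟩ := h2
  obtain ⟨z, -, hz, hz'⟩ := hs (interior t) (closure t)ᶜ isOpen_interior
    isClosed_closure.isOpen_compl hmem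
    ⟨x, hx, (hmem x hx).resolve_right fun h => h (subset_closure hxt)⟩
    ⟨y, hy, (hmem y hy).resolve_left fun h => hyt (interior_subset h)⟩
  exact hz' (subset_closure (interior_subset hz))

/-! ### The differential of the projection -/

namespace Surface

variable (S : Surface)

lemma contDiff_proj : ContDiff ℝ 2 S.proj := toCanvasL.contDiff.comp S.contDiff

lemma continuous_proj : Continuous S.proj := S.contDiff_proj.continuous

lemma continuous_height : Continuous fun x => height (S.f x) :=
  (EuclideanSpace.proj (𝕜 := ℝ) (2 : Fin 3)).continuous.comp S.contDiff.continuous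

lemma hasFDerivAt_proj (x : Plane) : HasFDerivAt S.proj (fderiv ℝ S.proj x) x :=
  (S.contDiff_proj.differentiable (by norm_num)).differentiableAt.hasFDerivAt

lemma fderiv_proj (x : Plane) : fderiv ℝ S.proj x = toCanvasL.comp (fderiv ℝ S.f x) :=
  (toCanvasL.hasFDerivAt.comp x
    (S.contDiff.differentiable (by norm_num)).differentiableAt.hasFDerivAt).fderiv

/-- The entry `∂ⱼgᵢ` of the Jacobian matrix of the projection. -/
noncomputable def jac (i j : Fin 2) (x : Plane) : ℝ :=
  fderiv ℝ S.proj x (EuclideanSpace.single j 1) i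

/-- The third component of the cross product only involves canvas components, so `facing` is the
Jacobian determinant of `g`. -/
lemma facing_eq (x : Plane) :
    S.facing x = S.jac 0 0 x * S.jac 1 1 x - S.jac 1 0 x * S.jac 0 1 x := by
  simp [facing, normal, jac, fderiv_proj, toCanvasL_apply, toCanvas, cross_apply]

lemma continuous_jac (i j : Fin 2) : Continuous (S.jac i j) :=
  (EuclideanSpace.proj (𝕜 := ℝ) i).continuous.comp
    ((S.contDiff_proj.continuous_fderiv (by norm_num)).clm_apply continuous_const)

lemma continuous_facing : Continuous S.facing := by
  have : S.facing = fun x => S.jac 0 0 x * S.jac 1 1 x - S.jac 1 0 x * S.jac 0 1 x :=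
    funext S.facing_eq
  rw [this]
  have := S.continuous_jac
  fun_prop

lemma fderiv_proj_apply (x v : Plane) (i : Fin 2) :
    fderiv ℝ S.proj x v i = v 0 * S.jac i 0 x + v 1 * S.jac i 1 x := by
  have hv : v = v 0 • EuclideanSpace.single 0 1 + v 1 • EuclideanSpace.single 1 1 := by
    ext k; fin_cases k <;> simp
  conv_lhs => rw [hv]
  simp [jac]

variable {S}

lemma fderiv_proj_injective {x : Plane} (hx : S.facing x ≠ 0) :
    Function.Injective (fderiv ℝ S.proj x) := by
  rw [injective_iff_map_eq_zero]
  intro v hv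
  have h0 := S.fderiv_proj_apply x v 0
  have h1 := S.fderiv_proj_apply x v 1
  rw [hv] at h0 h1
  rw [S.facing_eq] at hx
  simp only [PiLp.zero_apply] at h0 h1
  ext k
  fin_cases k
  · refine (mul_eq_zero.1 (?_ : (S.jac 0 0 x * S.jac 1 1 x - S.jac 1 0 x * S.jac 0 1 x) *
      v 0 = 0)).resolve_left hx
    linear_combination S.jac 0 1 x * h1 - S.jac 1 1 x * h0
  · refine (mul_eq_zero.1 (?_ : (S.jac 0 0 x * S.jac 1 1 x - S.jac 1 0 x * S.jac 0 1 x) *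
      v 1 = 0)).resolve_left hx
    linear_combination S.jac 1 0 x * h0 - S.jac 0 0 x * h1

/-- The differential of `f` has rank two and only one direction is lost in the projection, so that
of `g` has rank at least one. -/
lemma exists_jac_ne_zero {x : Plane} (hx : x ∈ S.dom) : ∃ i j, S.jac i j x ≠ 0 := by
  by_contra! h
  have hinj := (injective_iff_map_eq_zero _).1 (S.immersion x hx)
  set a := fderiv ℝ S.f x (EuclideanSpace.single 0 1) with ha
  set b := fderiv ℝ S.f x (EuclideanSpace.single 1 1) with hb
  have ha0 : a 0 = 0 := by simpa [jac, fderiv_proj, toCanvasL_apply, toCanvas] using h 0 0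
  have ha1 : a 1 = 0 := by simpa [jac, fderiv_proj, toCanvasL_apply, toCanvas] using h 1 0
  have hb0 : b 0 = 0 := by simpa [jac, fderiv_proj, toCanvasL_apply, toCanvas] using h 0 1
  have hb1 : b 1 = 0 := by simpa [jac, fderiv_proj, toCanvasL_apply, toCanvas] using h 1 1
  -- If both columns are vertical, this combination of them vanishes.
  have key := hinj (b 2 • EuclideanSpace.single 0 1 - a 2 • EuclideanSpace.single 1 1) (by
    rw [map_sub, map_smul, map_smul, ← ha, ← hb]
    ext k; fin_cases k <;> simp [ha0, ha1, hb0, hb1, mul_comm])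
  have ha2 : a 2 = 0 := by simpa using congrArg (fun v : Plane => v 1) key
  have := hinj (EuclideanSpace.single 0 1) (by
    rw [← ha]; ext k; fin_cases k <;> simp [ha0, ha1, ha2])
  simpa using congrArg (fun v : Plane => v 0) this

/-- Off the contour generator the projection is open. -/
lemma map_nhds_proj {x : Plane} (hx : S.facing x ≠ 0) : map S.proj (𝓝 x) = 𝓝 (S.proj x) := by
  have hs : HasStrictFDerivAt S.proj (fderiv ℝ S.proj x) x :=
    S.contDiff_proj.contDiffAt.hasStrictFDerivAt (by norm_num)
  refine hs.map_nhds_eq_of_surj ?_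
  rw [LinearMap.range_eq_top]
  exact LinearMap.injective_iff_surjective.1 (fderiv_proj_injective hx)

lemma eventually_exists_preimage {x : Plane} (hx : S.facing x ≠ 0) {Φ : Plane → Prop}
    (h : ∀ᶠ y in 𝓝 x, Φ y) : ∀ᶠ p in 𝓝 (S.proj x), ∃ y, S.proj y = p ∧ Φ y := by
  rw [← map_nhds_proj hx]
  exact Filter.eventually_map.2 (h.mono fun y hy => ⟨y, rfl, hy⟩)

lemma eventually_injOn_proj {x : Plane} (hx : S.facing x ≠ 0) :
    ∃ N ∈ 𝓝 x, InjOn S.proj N := by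
  have hs : HasStrictFDerivAt S.proj (fderiv ℝ S.proj x) x :=
    S.contDiff_proj.contDiffAt.hasStrictFDerivAt (by norm_num)
  have hi := fderiv_proj_injective hx
  let e := (LinearEquiv.ofInjectiveEndo (fderiv ℝ S.proj x).toLinearMap hi).toContinuousLinearEquiv
  have hs' : HasStrictFDerivAt S.proj (e : Plane →L[ℝ] Plane) x := by
    have he : (e : Plane →L[ℝ] Plane) = fderiv ℝ S.proj x := by ext v; rfl
    rwa [he]
  refine ⟨(hs'.toOpenPartialHomeomorph S.proj).source,
    (hs'.toOpenPartialHomeomorph S.proj).open_source.mem_nhds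
      hs'.mem_toOpenPartialHomeomorph_source, ?_⟩
  simpa using (hs'.toOpenPartialHomeomorph S.proj).injOn

/-! ### Elementary consequences of the assumptions -/

lemma SketchAssumption.isCompact_dom (hS : S.SketchAssumption) : IsCompact S.dom := by
  obtain ⟨e⟩ := hS.disk
  have : CompactSpace (Metric.closedBall (0 : Plane) 1) :=
    isCompact_iff_compactSpace.1 (isCompact_closedBall _ _)
  exact isCompact_iff_compactSpace.2 e.symm.compactSpace

lemma SketchAssumption.isClosed_dom (hS : S.SketchAssumption) : IsClosed S.dom :=
  hS.isCompact_dom.isClosed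

lemma SketchAssumption.isPreconnected_dom (hS : S.SketchAssumption) : IsPreconnected S.dom := by
  obtain ⟨e⟩ := hS.disk
  have : PreconnectedSpace (Metric.closedBall (0 : Plane) 1) :=
    isPreconnected_iff_preconnectedSpace.1 (convex_closedBall _ _).isPreconnected
  have : PreconnectedSpace S.dom := e.symm.surjective.denseRange.preconnectedSpace e.symm.continuous
  exact isPreconnected_iff_preconnectedSpace.2 this

lemma SketchAssumption.nontrivial_dom (hS : S.SketchAssumption) : S.dom.Nontrivial := by
  obtain ⟨e⟩ := hS.disk
  let a : Metric.closedBall (0 : Plane) 1 := ⟨0, by simp⟩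
  let b : Metric.closedBall (0 : Plane) 1 := ⟨EuclideanSpace.single 0 1, by simp⟩
  refine ⟨e.symm a, (e.symm a).2, e.symm b, (e.symm b).2, fun h => ?_⟩
  have h1 : a = b := e.symm.injective (Subtype.ext h)
  simpa [a, b] using congrArg (fun v : Metric.closedBall (0 : Plane) 1 => (v : Plane) 0) h1

lemma SketchAssumption.bdry_subset (hS : S.SketchAssumption) : S.bdry ⊆ S.dom :=
  hS.isClosed_dom.frontier_subset

lemma SketchAssumption.isClosed_area (hS : S.SketchAssumption) : IsClosed S.area :=
  (hS.isCompact_dom.image S.continuous_proj).isClosed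

lemma SketchAssumption.isClosed_proj_bdry (hS : S.SketchAssumption) :
    IsClosed (S.proj '' S.bdry) :=
  ((hS.isCompact_dom.of_isClosed_subset isClosed_frontier hS.bdry_subset).image
    S.continuous_proj).isClosed

/-- Of three surface points with the same projection, two agree. -/
lemma SketchAssumption.three_preimages (hS : S.SketchAssumption) {x y z : Plane}
    (hx : x ∈ S.dom) (hy : y ∈ S.dom) (hz : z ∈ S.dom) (hxy : S.proj x = S.proj y)
    (hxz : S.proj x = S.proj z) : x = y ∨ x = z ∨ y = z := by
  by_contra! h
  obtain ⟨h1, h2, h3⟩ := h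
  have hi := hS.no_self_intersection
  have hsub : ({S.f x, S.f y, S.f z} : Set Space) ⊆ {P ∈ S.points | toCanvas P = S.proj x} := by
    rintro P (rfl | rfl | rfl)
    · exact ⟨mem_image_of_mem _ hx, rfl⟩
    · exact ⟨mem_image_of_mem _ hy, hxy.symm⟩
    · exact ⟨mem_image_of_mem _ hz, hxz.symm⟩
  have hcard := (encard_le_encard hsub).trans (hS.two_points _)
  rw [encard_insert_of_notMem, encard_pair (fun h => h3 (hi hy hz h))] at hcard
  · norm_num at hcard
  · rintro (h | h)
    · exact h1 (hi hx hy h)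
    · exact h2 (hi hx hz h)

lemma SketchAssumption.eq_of_height_eq (hS : S.SketchAssumption) {x y : Plane}
    (hx : x ∈ S.dom) (hy : y ∈ S.dom) (hxy : S.proj x = S.proj y)
    (hh : height (S.f x) = height (S.f y)) : x = y := by
  refine hS.no_self_intersection hx hy ?_
  have h0 : S.f x 0 = S.f y 0 := by simpa [proj, toCanvas] using congrArg (fun v : Plane => v 0) hxy
  have h1 : S.f x 1 = S.f y 1 := by simpa [proj, toCanvas] using congrArg (fun v : Plane => v 1) hxy
  ext k
  fin_cases k
  exacts [h0, h1, hh]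

/-- The boundary of the domain has no isolated points. -/
lemma SketchAssumption.exists_mem_bdry_ne (hS : S.SketchAssumption) {b : Plane}
    (hb : b ∈ S.bdry) {N : Set Plane} (hN : N ∈ 𝓝 b) : ∃ b' ∈ N ∩ S.bdry, b' ≠ b := by
  by_contra! h
  obtain ⟨r, hr, hrN⟩ := Metric.mem_nhds_iff.1 hN
  have hdis : ¬ ((Metric.ball b r \ {b}) ∩ frontier S.dom).Nonempty := by
    rintro ⟨x, ⟨hx, hxb⟩, hxf⟩
    exact hxb (h x ⟨hrN hx, hxf⟩)
  have hbD := hS.bdry_subset hb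
  by_cases h1 : ((Metric.ball b r \ {b}) ∩ S.dom).Nonempty
  · by_cases h2 : ((Metric.ball b r \ {b}) ∩ S.domᶜ).Nonempty
    · exact hdis
        ((Plane.ball_diff_singleton_isPreconnected b r).inter_frontier_nonempty_of_inter_compl h1 h2)
    -- Here the whole ball lies in `D`, so `b` is interior.
    · have : Metric.ball b r ⊆ S.dom := by
        intro x hx
        by_contra hxD
        exact h2 ⟨x, ⟨hx, fun e => hxD (by rw [mem_singleton_iff.1 e]; exact hbD)⟩, hxD⟩
      exact hb.2 (mem_interior.2 ⟨_, this, Metric.isOpen_ball, Metric.mem_ball_self hr⟩)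
  -- Here `b` is isolated in `D`, which is connected and has another point.
  · obtain ⟨y, hy, hyb⟩ := hS.nontrivial_dom.exists_ne b
    obtain ⟨x, hxD, hx⟩ := hS.isPreconnected_dom (Metric.ball b r) {b}ᶜ Metric.isOpen_ball
      isOpen_compl_singleton (fun x _ => by
        by_cases e : x = b
        · left; rw [e]; exact Metric.mem_ball_self hr
        · right; exact e) ⟨b, hbD, Metric.mem_ball_self hr⟩ ⟨y, hy, hyb⟩
    exact h1 ⟨x, hx, hxD⟩

/-! ### Structural lines and minimal regions -/

lemma structuralLines_eq (S : Surface) :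
    S.structuralLines = S.proj '' S.bdry ∪ frontier S.area := by
  have : S.visibleBdry ∪ S.occludedBdry = S.bdry := by
    ext x; simp only [visibleBdry, occludedBdry, mem_union, mem_ofPred_eq]; tauto
  rw [structuralLines, ← image_union, this, contourLines, union_sdiff_self]

lemma SketchAssumption.isOpen_compl_lines (hS : S.SketchAssumption) :
    IsOpen (S.area \ S.structuralLines) := by
  have : S.area \ S.structuralLines = interior S.area \ S.proj '' S.bdry := by
    rw [structuralLines_eq, hS.isClosed_area.frontier_eq]
    ext x
    have := @interior_subset _ _ S.area x
    simp only [Set.mem_sdiff, mem_union]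
    tauto
  rw [this]
  exact isOpen_interior.sdiff hS.isClosed_proj_bdry

lemma mem_bdry_union_contourGenerator {x : Plane} (hx : x ∈ S.dom)
    (h : x ∉ S.bdry ∪ S.contourGenerator) :
    x ∈ interior S.dom ∧ S.facing x ≠ 0 := by
  have hi : x ∈ interior S.dom := by
    by_contra hi
    exact h (Or.inl ⟨subset_closure hx, hi⟩)
  exact ⟨hi, fun h0 => h (Or.inr ⟨hi, h0⟩)⟩

/-- Used in contrapositive form: over a frontier point of the area there are only boundary points
and contour generator points. -/
lemma proj_mem_interior_area {x : Plane} (hx : x ∈ interior S.dom) (h : S.facing x ≠ 0) :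
    S.proj x ∈ interior S.area := by
  rw [mem_interior_iff_mem_nhds]
  filter_upwards [eventually_exists_preimage h (mem_interior_iff_mem_nhds.1 hx)]
  rintro p ⟨y, rfl, hy⟩
  exact ⟨y, hy, rfl⟩

end Surface

lemma eventually_mem_of_mem_interior {X : Type*} [TopologicalSpace X] {s : Set X} {x : X}
    (hx : x ∈ interior s) : ∀ᶠ y in 𝓝 x, y ∈ s :=
  mem_interior_iff_mem_nhds.1 hx

namespace Surface

variable {S : Surface} {M : Set Plane}

lemma IsMinimalRegion.subset (hM : S.IsMinimalRegion M) : M ⊆ S.area \ S.structuralLines := by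
  obtain ⟨p, hp, rfl⟩ := hM
  exact connectedComponentIn_subset _ _

lemma IsMinimalRegion.isPreconnected (hM : S.IsMinimalRegion M) : IsPreconnected M := by
  obtain ⟨p, hp, rfl⟩ := hM
  exact isPreconnected_connectedComponentIn

lemma IsMinimalRegion.isOpen (hM : S.IsMinimalRegion M) (hS : S.SketchAssumption) :
    IsOpen M := by
  obtain ⟨p, hp, rfl⟩ := hM
  exact hS.isOpen_compl_lines.connectedComponentIn

lemma IsMinimalRegion.subset_of_inter (hM : S.IsMinimalRegion M) {V : Set Plane}
    (hV : IsPreconnected V) (hVs : V ⊆ S.area \ S.structuralLines) (h : (V ∩ M).Nonempty) :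
    V ⊆ M := by
  obtain ⟨p, hp, rfl⟩ := hM
  obtain ⟨x, hxV, hxM⟩ := h
  rw [connectedComponentIn_eq hxM]
  exact hV.subset_connectedComponentIn hxV hVs

lemma IsMinimalRegion.eq_of_inter {M₁ M₂ : Set Plane} (h₁ : S.IsMinimalRegion M₁)
    (h₂ : S.IsMinimalRegion M₂) (h : (M₁ ∩ M₂).Nonempty) : M₁ = M₂ :=
  (h₂.subset_of_inter h₁.isPreconnected h₁.subset h).antisymm
    (h₁.subset_of_inter h₂.isPreconnected h₂.subset (by rwa [inter_comm]))

/-- A point of the frontier off the lines would have an open component, which meets `M` and hence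
equals it, although `M` is open. -/
lemma IsMinimalRegion.frontier_subset (hM : S.IsMinimalRegion M) (hS : S.SketchAssumption) :
    frontier M ⊆ S.structuralLines := by
  intro p hp
  by_contra hpL
  have hpR : p ∈ S.area := by
    have : closure M ⊆ S.area := closure_minimal (fun x hx => (hM.subset hx).1) hS.isClosed_area
    exact this hp.1
  have hM' : S.IsMinimalRegion (connectedComponentIn (S.area \ S.structuralLines) p) :=
    ⟨p, ⟨hpR, hpL⟩, rfl⟩
  have hpM' := mem_connectedComponentIn (show p ∈ S.area \ S.structuralLines from ⟨hpR, hpL⟩)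
  obtain ⟨x, hx⟩ := mem_closure_iff.1 hp.1 _ (hM'.isOpen hS) hpM'
  rw [hM'.eq_of_inter hM ⟨x, hx⟩] at hpM'
  exact hp.2 ((hM.isOpen hS).interior_eq.symm ▸ hpM')

/-- This is how the assumption on drawn contours enters: over a minimal region `g` is a local
diffeomorphism at every surface point. -/
lemma regular_of_proj_notMem (hcontour : S.ContoursDrawn) {x : Plane} (hx : x ∈ S.dom)
    (h : S.proj x ∉ S.structuralLines) : x ∈ interior S.dom ∧ S.facing x ≠ 0 := by
  refine mem_bdry_union_contourGenerator hx ?_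
  rintro (hb | hk)
  · exact h (structuralLines_eq S ▸ Or.inl (mem_image_of_mem _ hb))
  · exact h (hcontour x hk)

/-! ### The side shown by the visible part over a region -/

lemma SketchAssumption.exists_visible (hS : S.SketchAssumption) {p : Plane} (hp : p ∈ S.area) :
    ∃ x ∈ S.dom, S.proj x = p ∧ S.Visible x := by
  obtain ⟨x₀, hx₀, hp₀⟩ := hp
  have hc : IsCompact (S.dom ∩ S.proj ⁻¹' {p}) :=
    hS.isCompact_dom.inter_right (isClosed_singleton.preimage S.continuous_proj)
  obtain ⟨x, ⟨hx, hxp⟩, hmax⟩ := hc.exists_isMaxOn ⟨x₀, hx₀, hp₀⟩ S.continuous_height.continuousOn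
  refine ⟨x, hx, hxp, fun y hy hyx => hmax ⟨hy, hyx.trans hxp⟩⟩

lemma SketchAssumption.height_lt (hS : S.SketchAssumption) {x y : Plane} (hx : x ∈ S.dom)
    (hy : y ∈ S.dom) (hv : S.Visible x) (hyx : S.proj y = S.proj x) (hne : y ≠ x) :
    height (S.f y) < height (S.f x) :=
  (hv y hy hyx).lt_of_ne fun h => hne (hS.eq_of_height_eq hy hx hyx h)

/-- Near the projection of a visible point off the contour generator and the boundary, the
visible points face the canvas with the same side. -/
lemma SketchAssumption.eventually_visible_facing (hS : S.SketchAssumption) {x : Plane}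
    (hx : x ∈ interior S.dom) (hf : S.facing x ≠ 0) (hv : S.Visible x) :
    ∀ᶠ p in 𝓝 (S.proj x), ∀ y ∈ S.dom, S.proj y = p → S.Visible y →
      0 < S.facing y * S.facing x := by
  have hxD := interior_subset hx
  -- The level `c` separates `x` from the other point below it, if there is one. Nearby fibres
  -- always contain a point above `c` near `x`, and their points below `c` are therefore occluded.
  obtain ⟨c, hc, hcx⟩ : ∃ c, (∀ y ∈ S.dom, S.proj y = S.proj x → y ≠ x → height (S.f y) < c) ∧
      c < height (S.f x) := by
    by_cases h : ∃ y ∈ S.dom, S.proj y = S.proj x ∧ y ≠ x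
    · obtain ⟨y, hy, hyx, hne⟩ := h
      obtain ⟨c, hc1, hc2⟩ := exists_between (hS.height_lt hxD hy hv hyx hne)
      refine ⟨c, fun z hz hzx hzne => ?_, hc2⟩
      rcases hS.three_preimages hxD hy hz hyx.symm hzx.symm with h | h | h
      · exact absurd h.symm hne
      · exact absurd h.symm hzne
      · rwa [← h]
    · push Not at h
      exact ⟨height (S.f x) - 1, fun y hy hyx hne => absurd (h y hy hyx) hne, by linarith⟩
  have hfc : ∀ᶠ y in 𝓝 x, 0 < S.facing y * S.facing x :=
    (S.continuous_facing.mul continuous_const).continuousAt.eventually_const_lt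
      (mul_self_pos.2 hf)
  have hup := eventually_exists_preimage hf ((eventually_mem_of_mem_interior hx).and
    (S.continuous_height.continuousAt.eventually_const_lt hcx))
  have hall := hS.isCompact_dom.eventually_forall_preimage S.continuous_proj (p := S.proj x)
    (Φ := fun y => 0 < S.facing y * S.facing x ∨ height (S.f y) < c) (by
      intro y hy hyx
      by_cases h : y = x
      · rw [h]; exact hfc.mono fun _ => Or.inl
      · exact (S.continuous_height.continuousAt.eventually_lt_const (hc y hy hyx h)).mono
          fun _ => Or.inr)
  filter_upwards [hup, hall] with p hup hall y hy hyp hyv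
  obtain ⟨x', hx'p, hx', hx'c⟩ := hup
  refine (hall y hy hyp).resolve_right fun h => ?_
  have := hyv x' hx' (hx'p.trans hyp.symm)
  linarith

/-- Over a minimal region the visible part faces the canvas with one and the same side. -/
lemma IsMinimalRegion.facing_mul_pos (hM : S.IsMinimalRegion M) (hcontour : S.ContoursDrawn)
    (hS : S.SketchAssumption) {x y : Plane} (hx : x ∈ S.visiblePart M)
    (hy : y ∈ S.visiblePart M) : 0 < S.facing x * S.facing y := by
  have key : ∀ p ∈ M, ∃ z ∈ S.dom, S.proj z = p ∧ S.Visible z ∧ S.facing z ≠ 0 ∧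
      ∀ᶠ p' in 𝓝 p, ∀ w ∈ S.dom, S.proj w = p' → S.Visible w →
        0 < S.facing w * S.facing z := by
    intro p hp
    obtain ⟨z, hz, rfl, hzv⟩ := hS.exists_visible (hM.subset hp).1
    obtain ⟨hzi, hzf⟩ := regular_of_proj_notMem hcontour hz (hM.subset hp).2
    exact ⟨z, hz, rfl, hzv, hzf, hS.eventually_visible_facing hzi hzf hzv⟩
  -- `P` and `Q` collect the canvas points near which visible points show the side of `x`, or the
  -- other side. They are open, cover `M` and are disjoint on `M`, so connectedness leaves only `P`.
  let P : Set Plane := {p | ∀ᶠ p' in 𝓝 p, ∀ w ∈ S.dom, S.proj w = p' → S.Visible w →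
    0 < S.facing w * S.facing x}
  let Q : Set Plane := {p | ∀ᶠ p' in 𝓝 p, ∀ w ∈ S.dom, S.proj w = p' → S.Visible w →
    S.facing w * S.facing x < 0}
  have hP : IsOpen P := isOpen_iff_mem_nhds.2 fun p hp => hp.eventually_nhds
  have hQ : IsOpen Q := isOpen_iff_mem_nhds.2 fun p hp => hp.eventually_nhds
  have hxf := (regular_of_proj_notMem hcontour hx.1 (hM.subset hx.2.1).2).2
  have hcov : M ⊆ P ∪ Q := by
    intro p hp
    obtain ⟨z, -, -, -, hzf, hz⟩ := key p hp
    rcases lt_or_gt_of_ne (mul_ne_zero hzf hxf) with h | h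
    · right
      filter_upwards [hz] with p' hp' w hw hwp hwv
      have := hp' w hw hwp hwv
      rcases pos_and_pos_or_neg_and_neg_of_mul_pos this with ⟨h1, h2⟩ | ⟨h1, h2⟩ <;>
      rcases mul_neg_iff.1 h with ⟨h3, h4⟩ | ⟨h3, h4⟩ <;> nlinarith
    · left
      filter_upwards [hz] with p' hp' w hw hwp hwv
      have := hp' w hw hwp hwv
      rcases pos_and_pos_or_neg_and_neg_of_mul_pos this with ⟨h1, h2⟩ | ⟨h1, h2⟩ <;>
      rcases pos_and_pos_or_neg_and_neg_of_mul_pos h with ⟨h3, h4⟩ | ⟨h3, h4⟩ <;> nlinarith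
  have hxP : S.proj x ∈ P := (hcov hx.2.1).resolve_right fun h => by
    have := h.self_of_nhds x hx.1 rfl hx.2.2
    nlinarith [mul_self_nonneg (S.facing x)]
  have hyP : S.proj y ∈ P := (hcov hy.2.1).resolve_right fun h => by
    obtain ⟨p, hp, hpP, hpQ⟩ := hM.isPreconnected P Q hP hQ hcov ⟨_, hx.2.1, hxP⟩ ⟨_, hy.2.1, h⟩
    obtain ⟨z, hz, hzp, hzv, -⟩ := key p hp
    have h1 := hpP.self_of_nhds z hz hzp hzv
    have h2 := hpQ.self_of_nhds z hz hzp hzv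
    linarith
  rw [mul_comm]
  exact hyP.self_of_nhds y hy.1 rfl hy.2.2

lemma IsMinimalRegion.visibleFront (hM : S.IsMinimalRegion M) (hcontour : S.ContoursDrawn)
    (hS : S.SketchAssumption) {x : Plane} (hx : x ∈ S.visiblePart M) (hf : 0 < S.facing x) :
    S.VisibleFront M := fun _ hy =>
  pos_of_mul_pos_right (hM.facing_mul_pos hcontour hS hx hy) hf.le

lemma IsMinimalRegion.visibleBack (hM : S.IsMinimalRegion M) (hcontour : S.ContoursDrawn)
    (hS : S.SketchAssumption) {x : Plane} (hx : x ∈ S.visiblePart M) (hf : S.facing x < 0) :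
    S.VisibleBack M := fun _ hy =>
  neg_of_mul_pos_right (hM.facing_mul_pos hcontour hS hx hy) hf.le

/-! ### Number and orientation of the sheets over a region -/

/-- Two points with the same projection, off the contour generator and the boundary, persist
for nearby points of the canvas. -/
lemma eventually_exists_two_preimages {x y : Plane} (hx : x ∈ interior S.dom)
    (hxf : S.facing x ≠ 0) (hy : y ∈ interior S.dom) (hyf : S.facing y ≠ 0)
    (hyx : S.proj y = S.proj x) (hne : y ≠ x) {Φ Ψ : Plane → Prop} (hΦ : ∀ᶠ z in 𝓝 x, Φ z)
    (hΨ : ∀ᶠ z in 𝓝 y, Ψ z) :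
    ∀ᶠ p in 𝓝 (S.proj x), ∃ x' ∈ S.dom, ∃ y' ∈ S.dom, S.proj x' = p ∧ S.proj y' = p ∧
      y' ≠ x' ∧ Φ x' ∧ Ψ y' := by
  obtain ⟨U, V, hU, hV, hyU, hxV, hUV⟩ := t2_separation hne
  have h1 := eventually_exists_preimage hxf (((eventually_mem_of_mem_interior hx).and
    (hV.eventually_mem hxV)).and hΦ)
  have h2 := eventually_exists_preimage hyf (((eventually_mem_of_mem_interior hy).and
    (hU.eventually_mem hyU)).and hΨ)
  rw [hyx] at h2
  filter_upwards [h1, h2]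
  rintro p ⟨x', hx'p, ⟨hx', hx'V⟩, hΦ'⟩ ⟨y', hy'p, ⟨hy', hy'U⟩, hΨ'⟩
  exact ⟨x', hx', y', hy', hx'p, hy'p, hUV.ne_of_mem hy'U hx'V, hΦ', hΨ'⟩

/-- A single point with a given projection, off the contour generator, remains single for nearby
points of the canvas. -/
lemma SketchAssumption.eventually_subsingleton_preimage (hS : S.SketchAssumption) {x : Plane}
    (hxf : S.facing x ≠ 0) (h : ∀ y ∈ S.dom, S.proj y = S.proj x → y = x) :
    ∀ᶠ p in 𝓝 (S.proj x), ∀ y ∈ S.dom, ∀ z ∈ S.dom, S.proj y = p → S.proj z = p → z = y := by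
  obtain ⟨N, hN, hinj⟩ := eventually_injOn_proj hxf
  filter_upwards [hS.isCompact_dom.eventually_forall_preimage S.continuous_proj
    (p := S.proj x) (Φ := fun y => y ∈ N) fun y hy hyx => by rwa [h y hy hyx]]
  intro p hp y hy z hz hyp hzp
  exact hinj (hp z hz hzp) (hp y hy hyp) (hzp.trans hyp.symm)

/-- Over a minimal region, all points of the canvas have the same number of preimages. -/
lemma IsMinimalRegion.exists_ne_preimage (hM : S.IsMinimalRegion M)
    (hcontour : S.ContoursDrawn) (hS : S.SketchAssumption) {x y : Plane} (hx : x ∈ S.dom)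
    (hy : y ∈ S.dom) (hxM : S.proj x ∈ M) (hyx : S.proj y = S.proj x) (hne : y ≠ x) {p : Plane}
    (hp : p ∈ M) : ∃ a ∈ S.dom, ∃ b ∈ S.dom, S.proj a = p ∧ S.proj b = p ∧ b ≠ a := by
  let P : Set Plane := {p | ∀ᶠ p' in 𝓝 p, ∃ x ∈ S.dom, ∃ y ∈ S.dom, S.proj x = p' ∧
    S.proj y = p' ∧ y ≠ x}
  let Q : Set Plane := {p | ∀ᶠ p' in 𝓝 p, ¬ ∃ x ∈ S.dom, ∃ y ∈ S.dom, S.proj x = p' ∧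
    S.proj y = p' ∧ y ≠ x}
  have hP : IsOpen P := isOpen_iff_mem_nhds.2 fun p hp => hp.eventually_nhds
  have hQ : IsOpen Q := isOpen_iff_mem_nhds.2 fun p hp => hp.eventually_nhds
  have hreg : ∀ z ∈ S.dom, S.proj z ∈ M → z ∈ interior S.dom ∧ S.facing z ≠ 0 := fun z hz hzM =>
    regular_of_proj_notMem hcontour hz (hM.subset hzM).2
  have hcov : M ⊆ P ∪ Q := by
    intro p hp
    by_cases hpP : ∃ x ∈ S.dom, ∃ y ∈ S.dom, S.proj x = p ∧ S.proj y = p ∧ y ≠ x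
    · left
      obtain ⟨x, hx, y, hy, rfl, hyx, hne⟩ := hpP
      obtain ⟨hxi, hxf⟩ := hreg x hx hp
      obtain ⟨hyi, hyf⟩ := hreg y hy (hyx ▸ hp)
      filter_upwards [eventually_exists_two_preimages hxi hxf hyi hyf hyx hne
        (Φ := fun _ => True) (Ψ := fun _ => True) (by simp) (by simp)]
      rintro p' ⟨x', hx', y', hy', hx'p, hy'p, hne', -⟩
      exact ⟨x', hx', y', hy', hx'p, hy'p, hne'⟩
    · right
      push Not at hpP
      obtain ⟨x, hx, rfl⟩ := (hM.subset hp).1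
      filter_upwards [hS.eventually_subsingleton_preimage (hreg x hx hp).2
        fun y hy hyx => hpP x hx y hy rfl hyx]
      rintro p' hp' ⟨a, ha, b, hb, hap, hbp, hba⟩
      exact hba (hp' a ha b hb hap hbp)
  have hxP : S.proj x ∈ P := (hcov hxM).resolve_right fun h =>
    h.self_of_nhds ⟨x, hx, y, hy, rfl, hyx, hne⟩
  have hpP : p ∈ P := (hcov hp).resolve_right fun h => by
    obtain ⟨p', -, hpP, hpQ⟩ := hM.isPreconnected P Q hP hQ hcov ⟨_, hxM, hxP⟩ ⟨_, hp, h⟩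
    exact hpQ.self_of_nhds hpP.self_of_nhds
  exact hpP.self_of_nhds

/-- If over some point of a minimal region there are two points that face the canvas with
different sides, then this is so over every point. -/
lemma IsMinimalRegion.opposite_facing_of_exists (hM : S.IsMinimalRegion M)
    (hcontour : S.ContoursDrawn) (hS : S.SketchAssumption)
    (h : ∃ x ∈ S.dom, ∃ y ∈ S.dom, S.proj x ∈ M ∧ S.proj y = S.proj x ∧
      S.facing x * S.facing y < 0)
    {x y : Plane} (hx : x ∈ S.dom) (hy : y ∈ S.dom) (hxM : S.proj x ∈ M)
    (hyx : S.proj y = S.proj x) (hne : y ≠ x) : S.facing x * S.facing y < 0 := by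
  let P : Set Plane := {p | ∀ᶠ p' in 𝓝 p, ∃ x ∈ S.dom, ∃ y ∈ S.dom, S.proj x = p' ∧
    S.proj y = p' ∧ S.facing x * S.facing y < 0}
  let Q : Set Plane := {p | ∀ᶠ p' in 𝓝 p, ¬ ∃ x ∈ S.dom, ∃ y ∈ S.dom, S.proj x = p' ∧
    S.proj y = p' ∧ S.facing x * S.facing y < 0}
  have hP : IsOpen P := isOpen_iff_mem_nhds.2 fun p hp => hp.eventually_nhds
  have hQ : IsOpen Q := isOpen_iff_mem_nhds.2 fun p hp => hp.eventually_nhds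
  have hreg : ∀ z ∈ S.dom, S.proj z ∈ M → z ∈ interior S.dom ∧ S.facing z ≠ 0 := fun z hz hzM =>
    regular_of_proj_notMem hcontour hz (hM.subset hzM).2
  have ne_of_neg : ∀ {a b : Plane}, S.facing a * S.facing b < 0 → b ≠ a := by
    rintro a b hab rfl
    nlinarith [mul_self_nonneg (S.facing b)]
  have hcov : M ⊆ P ∪ Q := by
    intro p hp
    by_cases hpP : ∃ x ∈ S.dom, ∃ y ∈ S.dom, S.proj x = p ∧ S.proj y = p ∧
        S.facing x * S.facing y < 0
    · left
      obtain ⟨x, hx, y, hy, rfl, hyx, hf⟩ := hpP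
      have hs : ∀ z, S.facing z ≠ 0 → ∀ᶠ w in 𝓝 z, 0 < S.facing w * S.facing z := fun z hz =>
        (S.continuous_facing.mul continuous_const).continuousAt.eventually_const_lt
          (mul_self_pos.2 hz)
      filter_upwards [eventually_exists_two_preimages (hreg x hx hp).1 (hreg x hx hp).2
        (hreg y hy (hyx ▸ hp)).1 (hreg y hy (hyx ▸ hp)).2 hyx (ne_of_neg hf)
        (hs x (hreg x hx hp).2) (hs y (hreg y hy (hyx ▸ hp)).2)]
      rintro p' ⟨x', hx', y', hy', hx'p, hy'p, -, h1, h2⟩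
      refine ⟨x', hx', y', hy', hx'p, hy'p, ?_⟩
      rcases mul_neg_iff.1 hf with ⟨h3, h4⟩ | ⟨h3, h4⟩
      · exact mul_neg_of_pos_of_neg (pos_of_mul_pos_left h1 h3.le) (neg_of_mul_pos_left h2 h4.le)
      · exact mul_neg_of_neg_of_pos (neg_of_mul_pos_left h1 h3.le) (pos_of_mul_pos_left h2 h4.le)
    · right
      -- Without an opposite pair over `p`, there are either two points showing the same side or a
      -- single point; both situations persist nearby.
      by_cases h2 : ∃ x ∈ S.dom, ∃ y ∈ S.dom, S.proj x = p ∧ S.proj y = p ∧ y ≠ x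
      · obtain ⟨x, hx, y, hy, rfl, hyx, hne⟩ := h2
        have hf : 0 < S.facing x * S.facing y := by
          refine lt_of_le_of_ne (not_lt.1 fun h => hpP ⟨x, hx, y, hy, rfl, hyx, h⟩) ?_
          exact (mul_ne_zero (hreg x hx hp).2 (hreg y hy (hyx ▸ hp)).2).symm
        have hs : ∀ z, S.facing z ≠ 0 → ∀ᶠ w in 𝓝 z, 0 < S.facing w * S.facing z := fun z hz =>
          (S.continuous_facing.mul continuous_const).continuousAt.eventually_const_lt
            (mul_self_pos.2 hz)
        filter_upwards [eventually_exists_two_preimages (hreg x hx hp).1 (hreg x hx hp).2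
          (hreg y hy (hyx ▸ hp)).1 (hreg y hy (hyx ▸ hp)).2 hyx hne
          (hs x (hreg x hx hp).2) (hs y (hreg y hy (hyx ▸ hp)).2)]
        rintro p' ⟨x', hx', y', hy', hx'p, hy'p, hne', h1, h2⟩ ⟨a, ha, b, hb, hap, hbp, hab⟩
        have h3 : 0 < S.facing x' * S.facing y' := by
          rcases pos_and_pos_or_neg_and_neg_of_mul_pos hf with ⟨h3, h4⟩ | ⟨h3, h4⟩
          · exact mul_pos (pos_of_mul_pos_left h1 h3.le) (pos_of_mul_pos_left h2 h4.le)
          · exact mul_pos_of_neg_of_neg (neg_of_mul_pos_left h1 h3.le)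
              (neg_of_mul_pos_left h2 h4.le)
        have hba := ne_of_neg hab
        -- The fibre is exhausted by the two persisting points, so an opposite pair would have to be
        -- this pair.
        have hmem : ∀ z ∈ S.dom, S.proj z = p' → z = x' ∨ z = y' := fun z hz hzp => by
          rcases hS.three_preimages hz hx' hy' (hzp.trans hx'p.symm) (hzp.trans hy'p.symm) with
            h | h | h
          exacts [Or.inl h, Or.inr h, absurd h.symm hne']
        rcases hmem a ha hap with rfl | rfl <;> rcases hmem b hb hbp with rfl | rfl
        · exact hba rfl
        · linarith
        · linarith [mul_comm (S.facing a) (S.facing b)]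
        · exact hba rfl
      · push Not at h2
        obtain ⟨x, hx, rfl⟩ := (hM.subset hp).1
        filter_upwards [hS.eventually_subsingleton_preimage (hreg x hx hp).2
          fun y hy hyx => h2 x hx y hy rfl hyx]
        rintro p' hp' ⟨a, ha, b, hb, hap, hbp, hab⟩
        exact ne_of_neg hab (hp' a ha b hb hap hbp)
  obtain ⟨a, ha, b, hb, haM, hba, hab⟩ := h
  have haP : S.proj a ∈ P := (hcov haM).resolve_right fun h =>
    h.self_of_nhds ⟨a, ha, b, hb, rfl, hba, hab⟩
  have hxP : S.proj x ∈ P := (hcov hxM).resolve_right fun h => by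
    obtain ⟨p, hp, hpP, hpQ⟩ := hM.isPreconnected P Q hP hQ hcov ⟨_, haM, haP⟩ ⟨_, hxM, h⟩
    exact hpQ.self_of_nhds hpP.self_of_nhds
  obtain ⟨c, hc, d, hd, hcx, hdx, hcd⟩ := hxP.self_of_nhds
  have hdc := ne_of_neg hcd
  have hmem : ∀ z ∈ S.dom, S.proj z = S.proj x → z = x ∨ z = y := fun z hz hzp => by
    rcases hS.three_preimages hz hx hy hzp (hzp.trans hyx.symm) with h | h | h
    exacts [Or.inl h, Or.inr h, absurd h.symm hne]
  rcases hmem c hc hcx with rfl | rfl <;> rcases hmem d hd hdx with rfl | rfl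
  · exact absurd rfl hdc
  · exact hcd
  · rwa [mul_comm]
  · exact absurd rfl hdc

end Surface

/-! ### Local inverses and level curves -/

/-- The inverse function theorem for maps of the plane into coordinates, on a box. -/
lemma exists_local_inverse {G : Plane → ℝ × ℝ} {x₀ : Plane} (hG : ContDiffAt ℝ 1 G x₀)
    (hinj : Function.Injective (fderiv ℝ G x₀)) {N : Set Plane} (hN : N ∈ 𝓝 x₀) :
    ∃ δ > 0, ∃ q : ℝ × ℝ → Plane,
      (∀ z ∈ Metric.ball (G x₀) δ, q z ∈ N ∧ G (q z) = z ∧ DifferentiableAt ℝ q z ∧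
        ContinuousAt G (q z) ∧ ∀ᶠ x in 𝓝 (q z), q (G x) = x) ∧
      ∀ᶠ x in 𝓝 x₀, G x ∈ Metric.ball (G x₀) δ ∧ q (G x) = x := by
  let e : Plane ≃L[ℝ] ℝ × ℝ := (LinearMap.linearEquivOfInjective
    (fderiv ℝ G x₀).toLinearMap hinj (by simp)).toContinuousLinearEquiv
  have he : (e : Plane →L[ℝ] ℝ × ℝ) = fderiv ℝ G x₀ := by ext v <;> rfl
  have hd : HasFDerivAt G (e : Plane →L[ℝ] ℝ × ℝ) x₀ := by
    rw [he]; exact (hG.differentiableAt (by norm_num)).hasFDerivAt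
  have hn : (1 : WithTop ℕ∞) ≠ 0 := by norm_num
  let T := hG.toOpenPartialHomeomorph G hd hn
  have hTG : ∀ x, T x = G x := fun x => rfl
  have hx₀ : x₀ ∈ T.source := hG.mem_toOpenPartialHomeomorph_source hd hn
  have hsymm : T.symm (G x₀) = x₀ := T.left_inv hx₀
  have hdiff : ∀ᶠ z in 𝓝 (G x₀), ContDiffAt ℝ 1 T.symm z :=
    (hG.to_localInverse hd hn).eventually (by simp)
  have hcont : ContinuousAt T.symm (G x₀) := hdiff.self_of_nhds.continuousAt
  have hN' : ∀ᶠ z in 𝓝 (G x₀), T.symm z ∈ N ∧ ContDiffAt ℝ 1 G (T.symm z) := by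
    have h : ∀ᶠ x in 𝓝 (T.symm (G x₀)), x ∈ N ∧ ContDiffAt ℝ 1 G x := by
      rw [hsymm]
      exact (show ∀ᶠ x in 𝓝 x₀, x ∈ N from hN).and (hG.eventually (by simp))
    exact hcont.eventually h
  have htarget : ∀ᶠ z in 𝓝 (G x₀), z ∈ T.target := T.open_target.mem_nhds (T.map_source hx₀)
  obtain ⟨δ, hδ, hball⟩ := Metric.eventually_nhds_iff_ball.1 ((hdiff.and hN').and htarget)
  refine ⟨δ, hδ, T.symm, fun z hz => ?_, ?_⟩
  · obtain ⟨⟨h1, h2, h3⟩, h4⟩ := hball z hz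
    exact ⟨h2, T.right_inv h4, h1.differentiableAt (by norm_num), h3.continuousAt,
      (T.open_source.eventually_mem (T.map_target h4)).mono fun x hx => T.left_inv hx⟩
  · filter_upwards [hG.continuousAt.eventually (Metric.ball_mem_nhds _ hδ),
      T.open_source.mem_nhds hx₀] with x h1 h2
    exact ⟨h1, T.left_inv h2⟩

lemma fderiv_apply_eq_coord (L : Plane →L[ℝ] ℝ) (v : Plane) {j k : Fin 2} (hjk : j ≠ k) :
    L v = v j * L (EuclideanSpace.single j 1) + v k * L (EuclideanSpace.single k 1) := by
  have hv : v = v j • EuclideanSpace.single j 1 + v k • EuclideanSpace.single k 1 := by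
    fin_cases j <;> fin_cases k <;> first | exact absurd rfl hjk | (ext l; fin_cases l <;> simp)
  conv_lhs => rw [hv]
  simp

/-- Near a regular point, two points of a level set are joined by a curve in this level set. -/
lemma exists_level_curve {F : Plane → ℝ} {x₀ : Plane} (hF : ContDiffAt ℝ 1 F x₀) {j k : Fin 2}
    (hjk : j ≠ k) (hj : fderiv ℝ F x₀ (EuclideanSpace.single j 1) ≠ 0) {N : Set Plane}
    (hN : N ∈ 𝓝 x₀) :
    ∃ N' ∈ 𝓝 x₀, ∀ x ∈ N', ∀ y ∈ N', F x = F y → ∃ a b, x k ∈ Ioo a b ∧ y k ∈ Ioo a b ∧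
      ∃ c : ℝ → Plane, c (x k) = x ∧ c (y k) = y ∧ ∀ v ∈ Ioo a b,
        c v ∈ N ∧ F (c v) = F x ∧ c v k = v ∧ DifferentiableAt ℝ c v := by
  have hk : ContDiff ℝ 1 fun x : Plane => x k := (EuclideanSpace.proj (𝕜 := ℝ) k).contDiff
  have hdk : HasFDerivAt (fun x : Plane => x k) (EuclideanSpace.proj (𝕜 := ℝ) k) x₀ :=
    (EuclideanSpace.proj (𝕜 := ℝ) k).hasFDerivAt
  -- In the coordinates `(F, x k)` the level sets of `F` are straight segments parametrized by `x
  -- k`.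
  have hG : ContDiffAt ℝ 1 (fun x => (F x, x k)) x₀ := hF.prodMk hk.contDiffAt
  have hd := ((hF.differentiableAt (by norm_num)).hasFDerivAt.prodMk hdk).fderiv
  have hinj : Function.Injective (fderiv ℝ (fun x => (F x, x k)) x₀) := by
    rw [hd, injective_iff_map_eq_zero]
    intro v hv
    obtain ⟨h1, h2⟩ := Prod.mk.inj hv
    have h1 : fderiv ℝ F x₀ v = 0 := h1
    have h2 : v k = 0 := h2
    rw [fderiv_apply_eq_coord _ v hjk, h2, zero_mul, add_zero] at h1
    have h1 := (mul_eq_zero.1 h1).resolve_right hj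
    ext l
    fin_cases j <;> fin_cases k <;> fin_cases l <;> simp_all
  obtain ⟨δ, hδ, q, hq, hq'⟩ := exists_local_inverse hG hinj hN
  refine ⟨_, hq', fun x hx y hy hxy => ⟨x₀ k - δ, x₀ k + δ, ?_⟩⟩
  obtain ⟨hx1, hx2⟩ := hx
  obtain ⟨hy1, hy2⟩ := hy
  simp only [← ball_prod_same, mem_prod, Real.ball_eq_Ioo] at hx1 hy1 hq
  refine ⟨hx1.2, hy1.2, fun v => q (F x, v), hx2, hxy ▸ hy2, fun v hv => ?_⟩
  obtain ⟨h1, h2, h3, -⟩ := hq (F x, v) ⟨hx1.1, hv⟩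
  refine ⟨h1, congrArg Prod.fst h2, congrArg Prod.snd h2, ?_⟩
  exact h3.comp v (by fun_prop)

lemma HasDerivAt.eventually_lt_right {φ : ℝ → ℝ} {a d : ℝ} (h : HasDerivAt φ d a) (hd : 0 < d) :
    ∀ᶠ v in 𝓝[>] a, φ a < φ v := by
  have := (hasDerivAt_iff_tendsto_slope.1 h).mono_left
    (nhdsWithin_mono a fun v (hv : a < v) => hv.ne')
  filter_upwards [this.eventually_const_lt hd, self_mem_nhdsWithin] with v hv hav
  rw [slope_def_field] at hv
  have := (div_pos_iff_of_pos_right (sub_pos.2 hav)).1 hv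
  linarith

lemma HasDerivAt.eventually_lt_left {φ : ℝ → ℝ} {a d : ℝ} (h : HasDerivAt φ d a) (hd : 0 < d) :
    ∀ᶠ v in 𝓝[<] a, φ v < φ a := by
  have := (hasDerivAt_iff_tendsto_slope.1 h).mono_left
    (nhdsWithin_mono a fun v (hv : v < a) => hv.ne)
  filter_upwards [this.eventually_const_lt hd, self_mem_nhdsWithin] with v hv hav
  rw [slope_def_field] at hv
  have := (div_pos_iff.1 hv).resolve_left fun h => by linarith [h.2, show v < a from hav]
  linarith

/-- The function exceeds the common value just after `a` and stays below it just before `b`, so it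
returns to it in between. The midpoint keeps the two test points in order. -/
lemma exists_eq_of_deriv_pos {φ : ℝ → ℝ} {a b d e : ℝ} (hab : a < b) (h : φ a = φ b)
    (hφ : ContinuousOn φ (Icc a b)) (ha : HasDerivAt φ d a) (hb : HasDerivAt φ e b)
    (hd : 0 < d) (he : 0 < e) : ∃ v ∈ Ioo a b, φ v = φ a := by
  have hm : a < (a + b) / 2 ∧ (a + b) / 2 < b := by constructor <;> linarith
  obtain ⟨v, hv, hav, hvm⟩ := ((ha.eventually_lt_right hd).and (Ioo_mem_nhdsGT hm.1)).exists
  obtain ⟨w, hw, hmw, hwb⟩ := ((hb.eventually_lt_left he).and (Ioo_mem_nhdsLT hm.2)).exists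
  have hvw : v ≤ w := by linarith
  obtain ⟨u, hu, hua⟩ := intermediate_value_Icc' hvw
    (hφ.mono (Icc_subset_Icc hav.le hwb.le)) (⟨by linarith, hv.le⟩ : φ a ∈ Icc (φ w) (φ v))
  exact ⟨u, ⟨by linarith [hu.1], by linarith [hu.2]⟩, hua⟩

lemma exists_eq_of_deriv_mul_pos {φ : ℝ → ℝ} {a b d e : ℝ} (hab : a < b) (h : φ a = φ b)
    (hφ : ContinuousOn φ (Icc a b)) (ha : HasDerivAt φ d a) (hb : HasDerivAt φ e b)
    (hde : 0 < d * e) : ∃ v ∈ Ioo a b, φ v = φ a := by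
  rcases pos_and_pos_or_neg_and_neg_of_mul_pos hde with ⟨hd, he⟩ | ⟨hd, he⟩
  · exact exists_eq_of_deriv_pos hab h hφ ha hb hd he
  · obtain ⟨v, hv, hv'⟩ := exists_eq_of_deriv_pos (φ := fun v => -φ v) hab (neg_inj.2 h) hφ.neg
      ha.neg hb.neg (neg_pos.2 hd) (neg_pos.2 he)
    exact ⟨v, hv, neg_inj.1 hv'⟩

/-! ### Folds at contour lines -/

namespace Surface

variable {S : Surface} {M : Set Plane}

lemma hasFDerivAt_proj_apply (i : Fin 2) (x : Plane) :
    HasFDerivAt (fun x => S.proj x i) ((EuclideanSpace.proj (𝕜 := ℝ) i).comp (fderiv ℝ S.proj x))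
      x :=
  (EuclideanSpace.proj (𝕜 := ℝ) i).hasFDerivAt.comp x (S.hasFDerivAt_proj x)

/-- Near a point of the surface, two points with the same projection that are the only ones
with this projection face the canvas with different sides. -/
lemma exists_fold_nhds {x₀ : Plane} (hx₀ : x₀ ∈ interior S.dom) :
    ∃ N ∈ 𝓝 x₀, ∀ x ∈ N, ∀ y ∈ N, x ≠ y → S.proj x = S.proj y →
      (∀ z ∈ S.dom, S.proj z = S.proj x → z = x ∨ z = y) → S.facing x ≠ 0 → S.facing y ≠ 0 →
      S.facing x * S.facing y < 0 := by
  -- The level curves are those of the canvas coordinate `i`, parametrized by the parameter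
  -- coordinate `k`; the coordinate `l` of `g` is followed along them.
  obtain ⟨i, j, hij⟩ := exists_jac_ne_zero (interior_subset hx₀)
  obtain ⟨k, hjk⟩ : ∃ k, j ≠ k := ⟨j + 1, by fin_cases j <;> simp⟩
  obtain ⟨l, hil⟩ : ∃ l, i ≠ l := ⟨i + 1, by fin_cases i <;> simp⟩
  have hN : ∀ᶠ x in 𝓝 x₀, x ∈ S.dom ∧ 0 < S.jac i j x * S.jac i j x₀ :=
    (eventually_mem_of_mem_interior hx₀).and (((S.continuous_jac i j).mul
      continuous_const).continuousAt.eventually_const_lt (mul_self_pos.2 hij))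
  have hF : ContDiff ℝ 1 fun x => S.proj x i :=
    (EuclideanSpace.proj (𝕜 := ℝ) i).contDiff.comp (S.contDiff_proj.of_le (by norm_num))
  obtain ⟨N', hN', hcurve⟩ := exists_level_curve hF.contDiffAt hjk
    (by rw [(hasFDerivAt_proj_apply i x₀).fderiv]; exact hij) hN
  have key : ∀ x ∈ N', ∀ y ∈ N', x k ≤ y k → x ≠ y → S.proj x = S.proj y →
      (∀ z ∈ S.dom, S.proj z = S.proj x → z = x ∨ z = y) →
      ¬ 0 < S.facing x * S.facing y := by
    intro x hx y hy hle hne hxy huniq hpos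
    obtain ⟨a, b, hxa, hya, c, hcx, hcy, hc⟩ := hcurve x hx y hy (by rw [hxy])
    have hlt : x k < y k := hle.lt_of_ne fun h => hne (by rw [← hcx, ← hcy, h])
    have hder : ∀ m, ∀ v ∈ Ioo a b, HasDerivAt (fun v => S.proj (c v) m)
        (deriv c v j * S.jac m j (c v) + S.jac m k (c v)) v := by
      intro m v hv
      have h1 := (hc v hv).2.2.2.hasDerivAt
      have h2 : HasDerivAt (fun v => c v k) (deriv c v k) v :=
        (EuclideanSpace.proj (𝕜 := ℝ) k).hasFDerivAt.comp_hasDerivAt v h1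
      have h3 : deriv c v k = 1 := h2.unique ((hasDerivAt_id v).congr_of_eventuallyEq
        (by filter_upwards [Ioo_mem_nhds hv.1 hv.2] with w hw using (hc w hw).2.2.1))
      have h4 := (hasFDerivAt_proj_apply (S := S) m (c v)).comp_hasDerivAt v h1
      rw [fderiv_apply_eq_coord _ _ hjk, h3, one_mul] at h4
      exact h4
    have hconst : ∀ v ∈ Ioo a b, deriv c v j * S.jac i j (c v) + S.jac i k (c v) = 0 := by
      intro v hv
      refine (hder i v hv).unique ((hasDerivAt_const v (S.proj x i)).congr_of_eventuallyEq ?_)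
      filter_upwards [Ioo_mem_nhds hv.1 hv.2] with w hw using (hc w hw).2.1
    -- Eliminating the derivative of `c` by `hconst` turns the derivative of coordinate `l`, times
    -- `S.jac i j`, into the Jacobian determinant up to sign.
    have hmul : ∀ v ∈ Ioo a b, (deriv c v j * S.jac l j (c v) + S.jac l k (c v)) * S.jac i j (c v) =
        S.jac l k (c v) * S.jac i j (c v) - S.jac l j (c v) * S.jac i k (c v) := by
      intro v hv
      linear_combination S.jac l j (c v) * hconst v hv
    -- The sign depends only on the choice of indices and cancels when the values at `x` and `y` are
    -- multiplied.
    have hdet : ∃ σ : ℝ, σ * σ = 1 ∧ ∀ z, S.jac l k z * S.jac i j z - S.jac l j z * S.jac i k z =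
        σ * S.facing z := by
      fin_cases i <;> fin_cases l <;> fin_cases j <;> fin_cases k <;>
        first
        | exact absurd rfl hil
        | exact absurd rfl hjk
        | exact ⟨1, by norm_num, fun z => by
            rw [S.facing_eq]; simp only [Fin.zero_eta, Fin.mk_one]; ring1⟩
        | exact ⟨-1, by norm_num, fun z => by
            rw [S.facing_eq]; simp only [Fin.zero_eta, Fin.mk_one]; ring1⟩
    obtain ⟨σ, hσ, hdet⟩ := hdet
    have hx' := hmul _ hxa
    have hy' := hmul _ hya
    have hjx := (hc _ hxa).1.2
    have hjy := (hc _ hya).1.2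
    have hdx := hder l _ hxa
    have hdy := hder l _ hya
    rw [hdet] at hx' hy'
    set d := deriv c (x k) j * S.jac l j (c (x k)) + S.jac l k (c (x k)) with hd
    set e := deriv c (y k) j * S.jac l j (c (y k)) + S.jac l k (c (y k)) with he
    rw [hcx] at hx' hjx
    rw [hcy] at hy' hjy
    have hde : 0 < d * e := by
      have h1 : 0 < S.jac i j x * S.jac i j y := by
        have := mul_pos hjx hjy
        rw [show S.jac i j x * S.jac i j x₀ * (S.jac i j y * S.jac i j x₀) =
          S.jac i j x * S.jac i j y * (S.jac i j x₀ * S.jac i j x₀) by ring] at this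
        exact pos_of_mul_pos_left this (mul_self_nonneg _)
      refine pos_of_mul_pos_left (b := S.jac i j x * S.jac i j y) ?_ h1.le
      calc 0 < S.facing x * S.facing y := hpos
        _ = (σ * S.facing x) * (σ * S.facing y) := by
          linear_combination (-(S.facing x * S.facing y)) * hσ
        _ = _ := by rw [← hx', ← hy']; ring
    have hsub : Icc (x k) (y k) ⊆ Ioo a b := Icc_subset_Ioo hxa.1 hya.2
    -- Equal signs at both ends give a third point of the fibre strictly between `x` and `y` on the
    -- curve.
    obtain ⟨v, hv, hvx⟩ := exists_eq_of_deriv_mul_pos hlt (by simp only [hcx, hcy, hxy])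
      (fun v hv => (hder l v (hsub hv)).continuousAt.continuousWithinAt) hdx hdy hde
    have hv' := hc v (hsub (Ioo_subset_Icc_self hv))
    rcases huniq (c v) hv'.1.1 (by
      ext m
      have h1 : S.proj (c v) i = S.proj x i := hv'.2.1
      have h2 : S.proj (c v) l = S.proj x l := by rw [hvx, hcx]
      fin_cases i <;> fin_cases l <;> fin_cases m <;>
        first | exact absurd rfl hil | exact h1 | exact h2) with h | h
    · exact hv.1.ne' (by rw [← hv'.2.2.1, h])
    · exact hv.2.ne (by rw [← hv'.2.2.1, h])
  refine ⟨N', hN', fun x hx y hy hne hxy huniq hfx hfy => ?_⟩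
  refine lt_of_le_of_ne (not_lt.1 ?_) (mul_ne_zero hfx hfy)
  rcases le_total (x k) (y k) with h | h
  · exact key x hx y hy h hne hxy huniq
  · rw [mul_comm]
    exact key y hy x hx h hne.symm hxy.symm fun z hz hzy => (huniq z hz (hzy.trans hxy.symm)).symm

/-- A minimal region meets the contour lines, if at all, outside the overlaps. -/
lemma IsMinimalRegion.exists_contour_notMem_overlaps (hM : S.IsMinimalRegion M)
    (hS : S.SketchAssumption) (h : (frontier M ∩ S.contourLines).Nonempty) :
    ∃ p ∈ frontier M ∩ S.contourLines, p ∉ S.overlaps := by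
  obtain ⟨p, hpM, hp⟩ := h
  by_cases hpo : p ∈ S.overlaps
  · obtain ⟨U, hU, hUp⟩ := hS.isolated_overlaps p hpo
    have hpU : p ∈ U := (hUp.symm ▸ mem_singleton p : p ∈ U ∩ S.overlaps).1
    obtain ⟨r, hr, hball⟩ := Metric.mem_nhds_iff.1
      (inter_mem (hU.mem_nhds hpU) (hS.isClosed_proj_bdry.isOpen_compl.mem_nhds hp.2))
    have hMo := hM.isOpen hS
    obtain ⟨x, hxb, hxM⟩ := mem_closure_iff.1 hpM.1 _ Metric.isOpen_ball (Metric.mem_ball_self hr)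
    have hpnM : p ∉ M := fun h => hpM.2 (hMo.interior_eq.symm ▸ h)
    -- Otherwise the ball would lie in the area, of which `p` is a frontier point.
    have hne : ((Metric.ball p r \ {p}) ∩ Mᶜ).Nonempty := by
      by_contra hne
      refine hp.1.2 (mem_interior.2 ⟨Metric.ball p r, fun y hy => ?_, Metric.isOpen_ball,
        Metric.mem_ball_self hr⟩)
      by_cases hyp : y = p
      · rw [hyp]; exact hS.isClosed_area.frontier_subset hp.1
      · by_contra hyR
        exact hne ⟨y, ⟨hy, hyp⟩, fun hyM => hyR (hM.subset hyM).1⟩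
    obtain ⟨y, ⟨hyb, hyp⟩, hyM⟩ :=
      (Plane.ball_diff_singleton_isPreconnected p r).inter_frontier_nonempty_of_inter_compl
      ⟨x, ⟨hxb, fun h => hpnM (mem_singleton_iff.1 h ▸ hxM)⟩, hxM⟩ hne
    refine ⟨y, ⟨hyM, ?_⟩, fun hyo => ?_⟩
    · have hyL := hM.frontier_subset hS hyM
      rw [structuralLines_eq] at hyL
      exact ⟨hyL.resolve_left (hball hyb).2, (hball hyb).2⟩
    · have : y ∈ U ∩ S.overlaps := ⟨(hball hyb).1, hyo⟩
      rw [hUp] at this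
      exact hyp this
  · exact ⟨p, ⟨hpM, hp⟩, hpo⟩

/-- Over a minimal region with an occluded part, the two points with the same projection face
the canvas with different sides. -/
lemma IsMinimalRegion.opposite_facing (hM : S.IsMinimalRegion M)
    (hcontour : S.ContoursDrawn) (hS : S.SketchAssumption)
    {x y : Plane} (hx : x ∈ S.dom) (hy : y ∈ S.dom) (hxM : S.proj x ∈ M)
    (hyx : S.proj y = S.proj x) (hne : y ≠ x) : S.facing x * S.facing y < 0 := by
  refine hM.opposite_facing_of_exists hcontour hS ?_ hx hy hxM hyx hne
  have hocc : (S.occludedPart M).Nonempty := by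
    rcases lt_trichotomy (height (S.f x)) (height (S.f y)) with h | h | h
    · exact ⟨x, hx, hxM, fun hv => (hv y hy hyx).not_gt h⟩
    · exact absurd (hS.eq_of_height_eq hx hy hyx.symm h).symm hne
    · exact ⟨y, hy, hyx ▸ hxM, fun hv => (hv x hx hyx.symm).not_gt h⟩
  obtain ⟨q, ⟨hqM, hq⟩, hqo⟩ :=
    hM.exists_contour_notMem_overlaps hS (hS.contour_of_occluded M hM hocc)
  -- All preimages of `q` count for overlaps, and `q` is not an overlap, so there is only one. It is
  -- not a boundary point because `q` lies on a contour line.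
  have hcrit : ∀ z ∈ S.dom, S.proj z = q → z ∈ S.bdry ∪ S.contourGenerator := by
    intro z hz hzq
    by_contra h
    obtain ⟨h1, h2⟩ := mem_bdry_union_contourGenerator hz h
    exact hq.1.2 (hzq ▸ proj_mem_interior_area h1 h2)
  obtain ⟨x₀, hx₀, hx₀q⟩ := hS.isClosed_area.frontier_subset hq.1
  have huniq : ∀ z ∈ S.dom, S.proj z = q → z = x₀ := by
    intro z hz hzq
    by_contra h
    exact hqo ⟨z, hcrit z hz hzq, x₀, hcrit x₀ hx₀ hx₀q, h, hzq, hx₀q⟩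
  have hx₀i : x₀ ∈ interior S.dom :=
    ((hcrit x₀ hx₀ hx₀q).resolve_left fun h => hq.2 ⟨x₀, h, hx₀q⟩).1
  obtain ⟨N, hN, hfold⟩ := exists_fold_nhds hx₀i
  have hnear := hS.isCompact_dom.eventually_forall_preimage S.continuous_proj (p := q)
    (Φ := fun z => z ∈ N) fun z hz hzq => by rw [huniq z hz hzq]; exact hN
  -- Close to `q`, the two points over a point of `M` both lie in the neighbourhood of `x₀` to which
  -- the fold argument applies.
  obtain ⟨p, hpN, hpM⟩ := mem_closure_iff_nhds.1 hqM.1 _ hnear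
  obtain ⟨a, ha, b, hb, rfl, hba, hne'⟩ := hM.exists_ne_preimage hcontour hS hx hy hxM hyx hne hpM
  refine ⟨a, ha, b, hb, hpM, hba, hfold a (hpN a ha rfl) b (hpN b hb hba) hne'.symm hba.symm
    (fun z hz hza => ?_) (regular_of_proj_notMem hcontour ha (hM.subset hpM).2).2
    (regular_of_proj_notMem hcontour hb (hM.subset (hba ▸ hpM)).2).2⟩
  rcases hS.three_preimages hz ha hb hza (hza.trans hba.symm) with h | h | h
  exacts [Or.inl h, Or.inr h, absurd h.symm hne']

/-! ### Occluded boundary lines -/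

lemma SketchAssumption.exists_bdry_notMem_overlaps (hS : S.SketchAssumption) {W : Set Plane}
    (hW : IsOpen W) (hne : (W ∩ S.bdry).Nonempty) :
    ∃ b ∈ W ∩ S.bdry, S.proj b ∉ S.overlaps := by
  obtain ⟨b, hbW, hb⟩ := hne
  by_cases hbo : S.proj b ∈ S.overlaps
  · obtain ⟨U, hU, hUp⟩ := hS.isolated_overlaps _ hbo
    have hbU : S.proj b ∈ U := (hUp.symm ▸ mem_singleton _ : S.proj b ∈ U ∩ S.overlaps).1
    have hN : ∀ᶠ x in 𝓝 b, x ∈ W ∧ S.proj x ∈ U :=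
      (hW.eventually_mem hbW).and (S.continuous_proj.continuousAt.eventually
        (hU.eventually_mem hbU))
    obtain ⟨b₁, ⟨hb₁, hb₁'⟩, hne₁⟩ := hS.exists_mem_bdry_ne hb hN
    -- The nearby boundary point may have the same projection as `b`; then a third one cannot have
    -- it too.
    by_cases h₁ : S.proj b₁ = S.proj b
    · obtain ⟨b₂, ⟨⟨hb₂, hb₂b⟩, hb₂'⟩, hne₂⟩ := hS.exists_mem_bdry_ne hb
        (hN.and (isOpen_compl_singleton.eventually_mem (show b ∈ {b₁}ᶜ from hne₁.symm)))
      refine ⟨b₂, ⟨hb₂.1, hb₂'⟩, fun ho => ?_⟩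
      have h₂ : S.proj b₂ ∈ U ∩ S.overlaps := ⟨hb₂.2, ho⟩
      rw [hUp] at h₂
      rcases hS.three_preimages (hS.bdry_subset hb) (hS.bdry_subset hb₁') (hS.bdry_subset hb₂')
        h₁.symm h₂.symm with h | h | h
      · exact hne₁ h.symm
      · exact hne₂ h.symm
      · exact hb₂b h.symm
    · refine ⟨b₁, ⟨hb₁.1, hb₁'⟩, fun ho => ?_⟩
      have h₂ : S.proj b₁ ∈ U ∩ S.overlaps := ⟨hb₁.2, ho⟩
      rw [hUp] at h₂
      exact h₁ h₂
  · exact ⟨b, ⟨hbW, hb⟩, hbo⟩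

/-- Outside the overlaps, whatever lies in front of or behind a boundary point belongs to a sheet on
which `g` is locally invertible. -/
lemma regular_of_notMem_overlaps {b x : Plane} (hb : b ∈ S.bdry) (ho : S.proj b ∉ S.overlaps)
    (hx : x ∈ S.dom) (hxb : S.proj x = S.proj b) (hne : x ≠ b) :
    x ∈ interior S.dom ∧ S.facing x ≠ 0 :=
  mem_bdry_union_contourGenerator hx fun h => ho ⟨x, h, b, Or.inl hb, hne, hxb, rfl⟩

lemma IsMinimalRegion.exists_visiblePart (hM : S.IsMinimalRegion M) (hS : S.SketchAssumption)
    {p : Plane} (hp : p ∈ M) : ∃ x ∈ S.visiblePart M, S.proj x = p := by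
  obtain ⟨x, hx, hxp, hv⟩ := hS.exists_visible (hM.subset hp).1
  exact ⟨x, ⟨hx, hxp ▸ hp, hv⟩, hxp⟩

/-- The visible point `y` over a suitable boundary point lies on a regular sheet. Visible points
over both regions, near the line, show the side that `y` shows. -/
lemma sameOrientation_of_shareLine_occluded (hcontour : S.ContoursDrawn)
    (hS : S.SketchAssumption) {M₁ M₂ : Set Plane} (h₁ : S.IsMinimalRegion M₁)
    (h₂ : S.IsMinimalRegion M₂) (h : S.ShareLine S.occludedBdry M₁ M₂) :
    S.SameOrientation M₁ M₂ := by
  obtain ⟨W, hW, hne, hocc, hfr⟩ := h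
  obtain ⟨b, hb, ho⟩ := hS.exists_bdry_notMem_overlaps hW hne
  have hbv : ¬ S.Visible b := (hocc hb).2
  have hbD := hS.bdry_subset hb.2
  obtain ⟨y, hy, hyb, hyv⟩ := hS.exists_visible ⟨b, hbD, rfl⟩
  have hyne : y ≠ b := fun h => hbv (h ▸ hyv)
  obtain ⟨hyi, hyf⟩ := regular_of_notMem_overlaps hb.2 ho hy hyb hyne
  have hev := hS.eventually_visible_facing hyi hyf hyv
  have hcl := hfr (mem_image_of_mem _ hb)
  rw [← hyb] at hcl
  have key : ∀ M, S.IsMinimalRegion M → S.proj y ∈ frontier M →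
      ∃ x ∈ S.visiblePart M, 0 < S.facing x * S.facing y := by
    intro M hM hyM
    obtain ⟨p, hp, hpM⟩ := mem_closure_iff_nhds.1 hyM.1 _ hev
    obtain ⟨x, hx, rfl⟩ := hM.exists_visiblePart hS hpM
    exact ⟨x, hx, hp x hx.1 rfl hx.2.2⟩
  obtain ⟨x₁, hx₁, hf₁⟩ := key M₁ h₁ hcl.1
  obtain ⟨x₂, hx₂, hf₂⟩ := key M₂ h₂ hcl.2
  rcases lt_or_gt_of_ne hyf with hn | hn
  · exact Or.inr ⟨h₁.visibleBack hcontour hS hx₁ (neg_of_mul_pos_left hf₁ hn.le),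
      h₂.visibleBack hcontour hS hx₂ (neg_of_mul_pos_left hf₂ hn.le)⟩
  · exact Or.inl ⟨h₁.visibleFront hcontour hS hx₁ (pos_of_mul_pos_left hf₁ hn.le),
      h₂.visibleFront hcontour hS hx₂ (pos_of_mul_pos_left hf₂ hn.le)⟩

/-! ### Charts at the surface boundary -/

/-- Coordinates near a point of the surface boundary, in which the domain is a half plane and
the projection preserves the first coordinate. -/
structure BoundaryChart (S : Surface) where
  /-- coordinates of the canvas -/
  A : Plane ≃L[ℝ] ℝ × ℝ
  /-- the inverse of the chart -/
  q : ℝ × ℝ → Plane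
  /-- first coordinate of the center -/
  u₀ : ℝ
  /-- radius of the box on which the chart is defined -/
  δ : ℝ
  δ_pos : 0 < δ
  continuousAt : ∀ z ∈ Ioo (u₀ - δ) (u₀ + δ) ×ˢ Ioo (-δ) δ, ContinuousAt q z
  image_mem_nhds : ∀ z ∈ Ioo (u₀ - δ) (u₀ + δ) ×ˢ Ioo (-δ) δ, ∀ O ∈ 𝓝 z, q '' O ∈ 𝓝 (q z)
  fst_eq : ∀ z ∈ Ioo (u₀ - δ) (u₀ + δ) ×ˢ Ioo (-δ) δ, (A (S.proj (q z))).1 = z.1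
  mem_interior : ∀ z ∈ Ioo (u₀ - δ) (u₀ + δ) ×ˢ Ioo (-δ) δ, z.2 < 0 → q z ∈ interior S.dom
  mem_bdry : ∀ z ∈ Ioo (u₀ - δ) (u₀ + δ) ×ˢ Ioo (-δ) δ, z.2 = 0 → q z ∈ S.bdry
  notMem : ∀ z ∈ Ioo (u₀ - δ) (u₀ + δ) ×ˢ Ioo (-δ) δ, 0 < z.2 → q z ∉ S.dom

namespace BoundaryChart

variable (C : BoundaryChart S)

/-- The box on which the chart is defined. -/
def box : Set (ℝ × ℝ) := Ioo (C.u₀ - C.δ) (C.u₀ + C.δ) ×ˢ Ioo (-C.δ) C.δ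

/-- The second canvas coordinate of the projection. -/
noncomputable def h (z : ℝ × ℝ) : ℝ := (C.A (S.proj (C.q z))).2

/-- The same chart with the second canvas coordinate reversed. -/
noncomputable def flip : BoundaryChart S where
  __ := C
  A := C.A.trans ((ContinuousLinearEquiv.refl ℝ ℝ).prodCongr (ContinuousLinearEquiv.neg ℝ))
  fst_eq := fun z hz => by simpa using C.fst_eq z hz

lemma flip_h (z : ℝ × ℝ) : C.flip.h z = -C.h z := rfl

lemma flip_A_fst (p : Plane) : (C.flip.A p).1 = (C.A p).1 := rfl

lemma flip_A_snd (p : Plane) : (C.flip.A p).2 = -(C.A p).2 := rfl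

/-- A smaller box lies in the box of the chart. -/
def SubBox (u r : ℝ) : Prop := 0 < r ∧ r < C.δ ∧ C.u₀ - C.δ < u - r ∧ u + r < C.u₀ + C.δ

variable {C}

lemma isOpen_box : IsOpen C.box := isOpen_Ioo.prod isOpen_Ioo

lemma SubBox.mem {u r : ℝ} (h : C.SubBox u r) {v s : ℝ} (hv : v ∈ Icc (u - r) (u + r))
    (hs : s ∈ Icc (-r) r) : (v, s) ∈ C.box := by
  obtain ⟨h1, h2, h3, h4⟩ := h
  exact ⟨⟨by linarith [hv.1], by linarith [hv.2]⟩, ⟨by linarith [hs.1], by linarith [hs.2]⟩⟩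

lemma SubBox.center {u r : ℝ} (h : C.SubBox u r) : (u, (0 : ℝ)) ∈ C.box :=
  h.mem ⟨by linarith [h.1], by linarith [h.1]⟩ ⟨by linarith [h.1], h.1.le⟩

lemma proj_q {z : ℝ × ℝ} (hz : z ∈ C.box) : S.proj (C.q z) = C.A.symm (z.1, C.h z) := by
  rw [ContinuousLinearEquiv.eq_symm_apply]
  exact Prod.ext (C.fst_eq z hz) rfl

lemma proj_q_eq_iff {z : ℝ × ℝ} (hz : z ∈ C.box) {p : Plane} :
    S.proj (C.q z) = p ↔ z.1 = (C.A p).1 ∧ C.h z = (C.A p).2 := by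
  rw [proj_q hz, ContinuousLinearEquiv.symm_apply_eq, Prod.ext_iff]

lemma A_proj_q_zero {z : ℝ × ℝ} (hz : z ∈ C.box) : C.A (S.proj (C.q z)) = (z.1, C.h z) :=
  Prod.ext (C.fst_eq z hz) rfl

lemma continuousAt_h {z : ℝ × ℝ} (hz : z ∈ C.box) : ContinuousAt C.h z :=
  continuousAt_snd.comp (C.A.continuous.continuousAt.comp
    (S.continuous_proj.continuousAt.comp (C.continuousAt z hz)))

lemma continuousAt_h_left {v s : ℝ} (hz : (v, s) ∈ C.box) : ContinuousAt (fun v => C.h (v, s)) v :=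
  (continuousAt_h hz).comp (f := fun v => (v, s)) (by fun_prop)

lemma continuousAt_h_right {v s : ℝ} (hz : (v, s) ∈ C.box) :
    ContinuousAt (fun s => C.h (v, s)) s :=
  (continuousAt_h hz).comp (f := fun s => (v, s)) (by fun_prop)

lemma q_mem_dom (hS : S.SketchAssumption) {z : ℝ × ℝ} (hz : z ∈ C.box) (h : z.2 ≤ 0) :
    C.q z ∈ S.dom := by
  rcases h.lt_or_eq with h | h
  · exact interior_subset (C.mem_interior z hz h)
  · exact hS.bdry_subset (C.mem_bdry z hz h)

lemma nonpos_of_q_mem_dom {z : ℝ × ℝ} (hz : z ∈ C.box) (h : C.q z ∈ S.dom) : z.2 ≤ 0 :=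
  not_lt.1 fun h0 => C.notMem z hz h0 h

lemma eq_zero_of_q_mem_bdry (hS : S.SketchAssumption) {z : ℝ × ℝ} (hz : z ∈ C.box)
    (h : C.q z ∈ S.bdry) : z.2 = 0 :=
  (nonpos_of_q_mem_dom hz (hS.bdry_subset h)).antisymm
    (not_lt.1 fun h0 => h.2 (C.mem_interior z hz h0))

lemma q_ne {z w : ℝ × ℝ} (hz : z ∈ C.box) (hw : w ∈ C.box) (h : z.2 < 0) (h' : w.2 = 0) :
    C.q z ≠ C.q w := fun e => (C.mem_bdry w hw h').2 (e ▸ C.mem_interior z hz h)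

lemma SubBox.image_mem_nhds {u r : ℝ} (h : C.SubBox u r) :
    C.q '' (Ioo (u - r) (u + r) ×ˢ Ioo (-r) r) ∈ 𝓝 (C.q (u, 0)) :=
  C.image_mem_nhds _ h.center _ ((isOpen_Ioo.prod isOpen_Ioo).mem_nhds
    ⟨⟨by linarith [h.1], by linarith [h.1]⟩, ⟨by linarith [h.1], h.1⟩⟩)

/-- Between values below and above the boundary value, the boundary value is attained. -/
lemma SubBox.exists_second_preimage {u r v a s : ℝ} (hb : C.SubBox u r)
    (hv : v ∈ Icc (u - r) (u + r)) (ha : -r ≤ a) (has : a ≤ s) (hs : s < 0)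
    (h1 : C.h (v, a) < C.h (v, 0)) (h2 : C.h (v, 0) < C.h (v, s)) :
    ∃ s' ∈ Icc a s, S.proj (C.q (v, s')) = S.proj (C.q (v, 0)) := by
  have hmem : ∀ t ∈ Icc a s, (v, t) ∈ C.box := fun t ht =>
    hb.mem hv ⟨by linarith [ht.1], by linarith [ht.2, hb.1]⟩
  obtain ⟨s', hs', he⟩ := intermediate_value_Icc has
    (fun t ht => (continuousAt_h_right (hmem t ht)).continuousWithinAt)
    (⟨h1.le, h2.le⟩ : C.h (v, 0) ∈ Icc (C.h (v, a)) (C.h (v, s)))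
  refine ⟨s', hs', ?_⟩
  rw [proj_q (hmem s' hs'), proj_q (hb.mem hv ⟨by linarith [hb.1], hb.1.le⟩)]
  exact congrArg (fun t => C.A.symm (v, t)) he

lemma SubBox.exists_preimage_below {u r v w : ℝ} (hb : C.SubBox u r)
    (hv : v ∈ Icc (u - r) (u + r)) (h1 : C.h (v, -r) < w) (h2 : w < C.h (v, 0)) :
    ∃ s ∈ Ioo (-r) 0, S.proj (C.q (v, s)) = C.A.symm (v, w) := by
  have hr := hb.1
  have hmem : ∀ t ∈ Icc (-r) 0, (v, t) ∈ C.box := fun t ht =>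
    hb.mem hv ⟨ht.1, by linarith [ht.2]⟩
  obtain ⟨s, hs, he⟩ := intermediate_value_Ioo (by linarith : -r ≤ 0)
    (fun t ht => (continuousAt_h_right (hmem t ht)).continuousWithinAt)
    (⟨h1, h2⟩ : w ∈ Ioo (C.h (v, -r)) (C.h (v, 0)))
  refine ⟨s, hs, ?_⟩
  rw [proj_q (hmem s (Ioo_subset_Icc_self hs))]
  exact congrArg (fun t => C.A.symm (v, t)) he

/-- The part of the canvas below the projected boundary, close to a boundary point, lies in one
minimal region, provided it is covered and no other boundary is projected there. -/
lemma SubBox.exists_side (hS : S.SketchAssumption) {u r : ℝ} (hb : C.SubBox u r)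
    (hbdry : ∀ᶠ p in 𝓝 (S.proj (C.q (u, 0))), ∀ y ∈ S.bdry, S.proj y = p →
      ∃ z ∈ Ioo (u - r) (u + r) ×ˢ Ioo (-r) r, C.q z = y)
    (harea : ∀ᶠ p in 𝓝 (S.proj (C.q (u, 0))), (C.A p).2 < C.h ((C.A p).1, 0) → p ∈ S.area) :
    ∃ V : Set Plane, IsPreconnected V ∧ V ⊆ S.area \ S.structuralLines ∧
      ∀ᶠ p in 𝓝 (S.proj (C.q (u, 0))), (C.A p).2 < C.h ((C.A p).1, 0) → p ∈ V := by
  have hr := hb.1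
  set w := C.h (u, 0) with hw
  have hp : C.A (S.proj (C.q (u, 0))) = (u, w) := A_proj_q_zero hb.center
  have hp' : C.A.symm (u, w) = S.proj (C.q (u, 0)) := by rw [← hp]; simp
  -- Boundary points projected nearby have second chart coordinate zero, hence land on the graph of
  -- `C.h (·, 0)` and not strictly below it.
  have hgood : ∀ᶠ z in 𝓝 (u, w), z.2 < C.h (z.1, 0) → C.A.symm z ∈ S.area \ S.structuralLines := by
    have hev : ∀ᶠ z in 𝓝 (u, w), z.1 ∈ Ioo (u - r) (u + r) :=
      continuousAt_fst.eventually (Ioo_mem_nhds (by simpa using hr) (by simpa using hr))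
    have hsymm : Tendsto C.A.symm (𝓝 (u, w)) (𝓝 (S.proj (C.q (u, 0)))) := by
      rw [← hp']; exact C.A.symm.continuous.continuousAt
    filter_upwards [hev, hsymm.eventually hbdry, hsymm.eventually harea.eventually_nhds] with
      z hz1 hz2 hz3 hlt
    have hzI : z.1 ∈ Icc (u - r) (u + r) := Ioo_subset_Icc_self hz1
    have hint : C.A.symm z ∈ interior S.area := by
      rw [mem_interior_iff_mem_nhds]
      have hc : ∀ᶠ p in 𝓝 (C.A.symm z), (C.A p).2 < C.h ((C.A p).1, 0) := by
        have hA : Tendsto C.A (𝓝 (C.A.symm z)) (𝓝 z) := by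
          have := C.A.continuous.continuousAt (x := C.A.symm z)
          simpa [ContinuousAt] using this
        have : ContinuousAt (fun z' : ℝ × ℝ => C.h (z'.1, 0)) z :=
          (continuousAt_h_left (hb.mem hzI ⟨by linarith, hr.le⟩)).comp continuousAt_fst
        exact hA.eventually (continuousAt_snd.eventually_lt this hlt)
      filter_upwards [hz3, hc] with p h1 h2 using h1 h2
    refine ⟨interior_subset hint, ?_⟩
    rw [structuralLines_eq]
    rintro (⟨y, hy, hyz⟩ | hfr)
    · obtain ⟨z', hz', rfl⟩ := hz2 y hy hyz
      have hbox : z' ∈ C.box := hb.mem (Ioo_subset_Icc_self hz'.1) (Ioo_subset_Icc_self hz'.2)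
      obtain ⟨h1, h2⟩ := (proj_q_eq_iff hbox).1 hyz
      simp only [ContinuousLinearEquiv.apply_symm_apply] at h1 h2
      have h0 := eq_zero_of_q_mem_bdry hS hbox hy
      rw [← h1, ← h2, show (z'.1, (0 : ℝ)) = z' from Prod.ext rfl h0.symm] at hlt
      exact lt_irrefl _ hlt
    · exact hfr.2 hint
  obtain ⟨ε, hε, hball⟩ := Metric.eventually_nhds_iff_ball.1 hgood
  simp only [← ball_prod_same, mem_prod, Real.ball_eq_Ioo, Prod.forall] at hball
  have hcont := continuousAt_h_left hb.center
  have hη : ∀ᶠ v in 𝓝 u, C.h (v, 0) ∈ Ioo (w - ε) (w + ε) :=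
    hcont.eventually (Ioo_mem_nhds (by linarith) (by linarith))
  obtain ⟨η, hη0, hη⟩ := Metric.eventually_nhds_iff_ball.1 (hη.and
    ((isOpen_Ioo.eventually_mem (show u ∈ Ioo (u - r) (u + r) by simpa using hr)).and
    (isOpen_Ioo.eventually_mem (show u ∈ Ioo (u - ε) (u + ε) by simpa using hε))))
  simp only [Real.ball_eq_Ioo] at hη
  -- `V` is the strip between the level `w - ε` and the graph, written as the image of a rectangle
  -- under vertical interpolation to make its connectedness evident.
  refine ⟨(fun z : ℝ × ℝ => C.A.symm (z.1, (1 - z.2) * (w - ε) + z.2 * C.h (z.1, 0))) ''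
    (Ioo (u - η) (u + η) ×ˢ Ioo 0 1), ?_, ?_, ?_⟩
  · refine ((convex_Ioo _ _).prod (convex_Ioo _ _)).isPreconnected.image _ fun z hz => ?_
    have h1 : ContinuousAt (fun z' : ℝ × ℝ => C.h (z'.1, 0)) z :=
      (continuousAt_h_left (hb.mem (Ioo_subset_Icc_self (hη _ hz.1).2.1)
        ⟨by linarith, hr.le⟩)).comp continuousAt_fst
    refine (C.A.symm.continuous.continuousAt.comp ?_).continuousWithinAt
    exact continuousAt_fst.prodMk (((continuousAt_const.sub continuousAt_snd).mul
      continuousAt_const).add (continuousAt_snd.mul h1))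
  · rintro p ⟨⟨v, t⟩, ⟨hv, ht0, ht1⟩, rfl⟩
    obtain ⟨h1, h2, h3⟩ := hη v hv
    dsimp only at *
    refine hball v _ ⟨h3, ?_, ?_⟩ ?_ <;> nlinarith [h1.1, h1.2]
  · have hA : Tendsto C.A (𝓝 (S.proj (C.q (u, 0)))) (𝓝 (u, w)) := by
      rw [← hp]; exact C.A.continuous.continuousAt
    have h1 : ∀ᶠ z in 𝓝 (u, w), z.1 ∈ Ioo (u - η) (u + η) ∧ w - ε < z.2 :=
      (continuousAt_fst.eventually (Ioo_mem_nhds (by simpa using hη0) (by simpa using hη0))).and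
        (continuousAt_snd.eventually_const_lt (by simpa using hε))
    filter_upwards [hA.eventually h1] with p hp1 hlt
    have hpos : 0 < C.h ((C.A p).1, 0) - (w - ε) := by linarith [hp1.2]
    refine ⟨((C.A p).1, ((C.A p).2 - (w - ε)) / (C.h ((C.A p).1, 0) - (w - ε))),
      ⟨hp1.1, div_pos (by linarith [hp1.2]) hpos, (div_lt_one hpos).2 (by linarith)⟩, ?_⟩
    rw [ContinuousLinearEquiv.symm_apply_eq]
    refine Prod.ext rfl ?_
    dsimp only
    field_simp
    ring

end BoundaryChart

/-! ### A second sheet over a shared boundary line -/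

namespace BoundaryChart

variable {C : BoundaryChart S}

/-- Along the boundary line of the chart `g` is injective, its first coordinate being `v`; so any
small change of `v` leaves an isolated overlap. -/
lemma exists_notMem_overlaps (hS : S.SketchAssumption) {u : ℝ} (hu : (u, (0 : ℝ)) ∈ C.box)
    {P : ℝ → Prop} (hP : ∀ᶠ v in 𝓝 u, P v) :
    ∃ v, P v ∧ (v, (0 : ℝ)) ∈ C.box ∧ S.proj (C.q (v, 0)) ∉ S.overlaps := by
  have hline : ContinuousAt (fun v : ℝ => (v, (0 : ℝ))) u := by fun_prop
  by_cases ho : S.proj (C.q (u, 0)) ∈ S.overlaps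
  · obtain ⟨U, hU, hUp⟩ := hS.isolated_overlaps _ ho
    have hpU : S.proj (C.q (u, 0)) ∈ U :=
      (hUp.symm ▸ mem_singleton _ : S.proj (C.q (u, 0)) ∈ U ∩ S.overlaps).1
    have hc : ContinuousAt (fun v => S.proj (C.q (v, 0))) u :=
      S.continuous_proj.continuousAt.comp
        ((C.continuousAt _ hu).comp (f := fun v => (v, (0 : ℝ))) hline)
    have hev := (hP.and ((hline.eventually (isOpen_box.eventually_mem hu)).and
      (hc.eventually (hU.eventually_mem hpU)))).filter_mono (nhdsWithin_le_nhds (s := {u}ᶜ))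
    obtain ⟨v, ⟨h1, h2, h3⟩, hvu⟩ := (hev.and self_mem_nhdsWithin).exists
    refine ⟨v, h1, h2, fun h => hvu ?_⟩
    have h4 : S.proj (C.q (v, 0)) ∈ U ∩ S.overlaps := ⟨h3, h⟩
    rw [hUp, mem_singleton_iff, proj_q_eq_iff h2] at h4
    exact h4.1.trans (C.fst_eq _ hu)
  · exact ⟨u, hP.self_of_nhds, hu, ho⟩

/-- Of two different minimal regions at the projected boundary, one is above it, if the
part below is covered and no other boundary is projected there. -/
lemma SubBox.eventually_above (hS : S.SketchAssumption) {u r : ℝ} (hb : C.SubBox u r)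
    (hbdry : ∀ᶠ p in 𝓝 (S.proj (C.q (u, 0))), ∀ y ∈ S.bdry, S.proj y = p →
      ∃ z ∈ Ioo (u - r) (u + r) ×ˢ Ioo (-r) r, C.q z = y)
    (harea : ∀ᶠ p in 𝓝 (S.proj (C.q (u, 0))), (C.A p).2 < C.h ((C.A p).1, 0) → p ∈ S.area)
    {M₁ M₂ : Set Plane} (h₁ : S.IsMinimalRegion M₁) (h₂ : S.IsMinimalRegion M₂)
    (hne : M₁ ≠ M₂) :
    (∀ᶠ p in 𝓝 (S.proj (C.q (u, 0))), p ∈ M₁ → C.h ((C.A p).1, 0) < (C.A p).2) ∨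
    (∀ᶠ p in 𝓝 (S.proj (C.q (u, 0))), p ∈ M₂ → C.h ((C.A p).1, 0) < (C.A p).2) := by
  obtain ⟨V, hV, hVs, hVp⟩ := hb.exists_side hS hbdry harea
  have hbox : ∀ᶠ p in 𝓝 (S.proj (C.q (u, 0))), ((C.A p).1, (0 : ℝ)) ∈ C.box := by
    have hc : ContinuousAt (fun p => ((C.A p).1, (0 : ℝ))) (S.proj (C.q (u, 0))) := by fun_prop
    refine hc.eventually (isOpen_box.eventually_mem ?_)
    simpa only [A_proj_q_zero hb.center] using hb.center
  -- Near the center, a region that misses the strip `V` has no points below the graph, and none on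
  -- it since the graph is projected boundary. Two distinct regions cannot both meet `V`.
  have key : ∀ M, S.IsMinimalRegion M → ¬ (V ∩ M).Nonempty →
      ∀ᶠ p in 𝓝 (S.proj (C.q (u, 0))), p ∈ M → C.h ((C.A p).1, 0) < (C.A p).2 := by
    intro M hM hVM
    filter_upwards [hVp, hbox] with p hp hpb hpM
    refine lt_of_le_of_ne (not_lt.1 fun h => hVM ⟨p, hp h, hpM⟩) fun he => ?_
    refine (hM.subset hpM).2 (structuralLines_eq S ▸ Or.inl ⟨_, C.mem_bdry _ hpb rfl, ?_⟩)
    exact (proj_q_eq_iff hpb).2 ⟨rfl, he⟩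
  by_cases h : (V ∩ M₁).Nonempty
  · refine Or.inr (key M₂ h₂ fun h' => hne (h₁.eq_of_inter h₂ ?_))
    obtain ⟨x, hxV, hx⟩ := h'
    exact ⟨x, h₁.subset_of_inter hV hVs h hxV, hx⟩
  · exact Or.inl (key M₁ h₁ h)

/-- Near the projection of a chart center, the part below the projected boundary is covered, if
the chart leads down there. -/
lemma SubBox.eventually_preimage_below {u r : ℝ} (hb : C.SubBox u r)
    (hlt : C.h (u, -r) < C.h (u, 0)) :
    ∀ᶠ p in 𝓝 (S.proj (C.q (u, 0))), (C.A p).1 ∈ Ioo (u - r) (u + r) ∧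
      C.h ((C.A p).1, -r) < C.h ((C.A p).1, 0) ∧ ((C.A p).2 < C.h ((C.A p).1, 0) →
        ∃ s ∈ Ioo (-r) 0, S.proj (C.q ((C.A p).1, s)) = p) := by
  have hr := hb.1
  have hu : u ∈ Icc (u - r) (u + r) := ⟨by linarith, by linarith⟩
  have hA := A_proj_q_zero hb.center
  have h1 : ContinuousAt (fun p => (C.A p).1) (S.proj (C.q (u, 0))) := by fun_prop
  have h2 : ContinuousAt (fun p => (C.A p).2) (S.proj (C.q (u, 0))) := by fun_prop
  have hh : ∀ s ∈ Icc (-r) r,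
      ContinuousAt (fun p => C.h ((C.A p).1, s)) (S.proj (C.q (u, 0))) := fun s hs => by
    refine ContinuousAt.comp (g := fun v => C.h (v, s)) ?_ h1
    rw [hA]
    exact continuousAt_h_left (hb.mem hu hs)
  have hm : -r ∈ Icc (-r) r := ⟨le_rfl, by linarith⟩
  have e1 : ∀ᶠ p in 𝓝 (S.proj (C.q (u, 0))), (C.A p).1 ∈ Ioo (u - r) (u + r) :=
    h1.eventually (Ioo_mem_nhds (by simp only [hA]; linarith) (by simp only [hA]; linarith))
  have e2 := (hh _ hm).eventually_lt (hh 0 ⟨by linarith, hr.le⟩) (by simpa only [hA] using hlt)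
  have e3 := (hh _ hm).eventually_lt h2 (by simpa only [hA] using hlt)
  filter_upwards [e1, e2, e3] with p hp1 hp2 hp3
  refine ⟨hp1, hp2, fun hlt => ?_⟩
  obtain ⟨s, hs, he⟩ := hb.exists_preimage_below (Ioo_subset_Icc_self hp1) hp3 hlt
  exact ⟨s, hs, he.trans (by simp)⟩

/-- By `huniq` all surface points over the vicinity lie in the chart. One of the two regions lies
above the graph, so some vertical chart line runs from below its boundary value to above it before
reaching the boundary, and takes that value on the way. The second preimage obtained may lie over
another boundary point than the center. -/
lemma SubBox.exists_other_preimage_aux (hS : S.SketchAssumption) {u r : ℝ} (hb : C.SubBox u r)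
    (hlt : C.h (u, -r) < C.h (u, 0))
    (huniq : ∀ x ∈ S.dom, S.proj x = S.proj (C.q (u, 0)) → x = C.q (u, 0))
    {M₁ M₂ : Set Plane} (h₁ : S.IsMinimalRegion M₁) (h₂ : S.IsMinimalRegion M₂) (hne : M₁ ≠ M₂)
    (hc₁ : S.proj (C.q (u, 0)) ∈ closure M₁) (hc₂ : S.proj (C.q (u, 0)) ∈ closure M₂) :
    ∃ v, (v, (0 : ℝ)) ∈ C.box ∧ S.proj (C.q (v, 0)) ∉ S.overlaps ∧
      ∃ x ∈ S.dom, x ≠ C.q (v, 0) ∧ S.proj x = S.proj (C.q (v, 0)) := by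
  have hr := hb.1
  have hnear : ∀ᶠ p in 𝓝 (S.proj (C.q (u, 0))), ∀ y ∈ S.dom, S.proj y = p →
      ∃ z ∈ Ioo (u - r) (u + r) ×ˢ Ioo (-r) r, C.q z = y :=
    hS.isCompact_dom.eventually_forall_preimage S.continuous_proj fun x hx hxp => by
      rw [huniq x hx hxp]
      exact hb.image_mem_nhds
  have hbelow := hb.eventually_preimage_below hlt
  have hdomq : ∀ v ∈ Ioo (u - r) (u + r), ∀ s ∈ Ioo (-r) 0, C.q (v, s) ∈ S.dom :=
    fun v hv s hs => q_mem_dom hS (hb.mem (Ioo_subset_Icc_self hv) ⟨hs.1.le, by linarith [hs.2]⟩)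
      hs.2.le
  have harea : ∀ᶠ p in 𝓝 (S.proj (C.q (u, 0))), (C.A p).2 < C.h ((C.A p).1, 0) → p ∈ S.area := by
    filter_upwards [hbelow] with p hp hlt
    obtain ⟨s, hs, he⟩ := hp.2.2 hlt
    exact ⟨_, hdomq _ hp.1 s hs, he⟩
  obtain ⟨m, hmR, hm, hmn, hmb⟩ : ∃ m ∈ S.area, C.h ((C.A m).1, 0) < (C.A m).2 ∧
      (∀ y ∈ S.dom, S.proj y = m → ∃ z ∈ Ioo (u - r) (u + r) ×ˢ Ioo (-r) r, C.q z = y) ∧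
      C.h ((C.A m).1, -r) < C.h ((C.A m).1, 0) := by
    rcases hb.eventually_above hS (hnear.mono fun p hp y hy => hp y (hS.bdry_subset hy)) harea
      h₁ h₂ hne with h | h
    · obtain ⟨m, ⟨hm1, hm2, hm3⟩, hmM⟩ := mem_closure_iff_nhds.1 hc₁ _ (h.and (hnear.and hbelow))
      exact ⟨m, (h₁.subset hmM).1, hm1 hmM, hm2, hm3.2.1⟩
    · obtain ⟨m, ⟨hm1, hm2, hm3⟩, hmM⟩ := mem_closure_iff_nhds.1 hc₂ _ (h.and (hnear.and hbelow))
      exact ⟨m, (h₂.subset hmM).1, hm1 hmM, hm2, hm3.2.1⟩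
  obtain ⟨y, hy, hym⟩ := hmR
  obtain ⟨⟨v, s⟩, ⟨hv, hs⟩, rfl⟩ := hmn y hy hym
  have hvs : (v, s) ∈ C.box := hb.mem (Ioo_subset_Icc_self hv) (Ioo_subset_Icc_self hs)
  obtain ⟨e1, e2⟩ := (proj_q_eq_iff hvs).1 hym
  dsimp only at e1 hv hs
  rw [← e1] at hm hmb
  rw [← e2] at hm
  have hs0 : s < 0 := (nonpos_of_q_mem_dom hvs hy).lt_of_ne (by rintro rfl; exact lt_irrefl _ hm)
  have hbox : ∀ t ∈ Icc (-r) r, (v, t) ∈ C.box := fun t ht => hb.mem (Ioo_subset_Icc_self hv) ht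
  have h0 : (0 : ℝ) ∈ Icc (-r) r := ⟨by linarith, hr.le⟩
  -- The inequalities are strict, so `v` can still be moved off the overlaps.
  have ev := (isOpen_Ioo.eventually_mem hv).and
    (((continuousAt_h_left (hbox (-r) ⟨le_rfl, by linarith⟩)).eventually_lt
      (continuousAt_h_left (hbox 0 h0)) hmb).and
    ((continuousAt_h_left (hbox 0 h0)).eventually_lt (continuousAt_h_left hvs) hm))
  obtain ⟨v', ⟨hv', hlt1, hlt2⟩, hv'b, hv'o⟩ := exists_notMem_overlaps hS (hbox 0 h0) ev
  have hv'I := Ioo_subset_Icc_self hv'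
  obtain ⟨s', hs', he⟩ := hb.exists_second_preimage hv'I le_rfl hs.1.le hs0 hlt1 hlt2
  have hs'b : (v', s') ∈ C.box := hb.mem hv'I ⟨hs'.1, by linarith [hs'.2]⟩
  have hs'0 : s' < 0 := by linarith [hs'.2]
  exact ⟨v', hv'b, hv'o, C.q (v', s'), q_mem_dom hS hs'b hs'0.le, q_ne hs'b hv'b hs'0 rfl, he⟩

lemma exists_subBox {u : ℝ} (hu : (u, (0 : ℝ)) ∈ C.box) {P : ℝ × ℝ → Prop}
    (hP : ∀ᶠ z in 𝓝 (u, (0 : ℝ)), P z) :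
    ∃ r, C.SubBox u r ∧ ∀ z ∈ Icc (u - r) (u + r) ×ˢ Icc (-r) r, P z := by
  obtain ⟨ε, hε, h⟩ := Metric.eventually_nhds_iff_ball.1
    (hP.and (isOpen_box.eventually_mem hu))
  simp only [← ball_prod_same, mem_prod, Real.ball_eq_Ioo] at h
  have hsub : ∀ z ∈ Icc (u - ε / 2) (u + ε / 2) ×ˢ Icc (-(ε / 2)) (ε / 2), P z ∧ z ∈ C.box :=
    fun z hz => h z ⟨⟨by linarith [hz.1.1], by linarith [hz.1.2]⟩,
      ⟨by linarith [hz.2.1], by linarith [hz.2.2]⟩⟩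
  have h1 := (hsub (u - ε / 2, ε / 2) ⟨⟨le_rfl, by linarith⟩, ⟨by linarith, le_rfl⟩⟩).2
  have h2 := (hsub (u + ε / 2, ε / 2) ⟨⟨by linarith, le_rfl⟩, ⟨by linarith, le_rfl⟩⟩).2
  exact ⟨ε / 2, ⟨by linarith, h1.2.2, h1.1.1, h2.1.2⟩, fun z hz => (hsub z hz).1⟩

lemma exists_other_preimage (hS : S.SketchAssumption)
    {M₁ M₂ : Set Plane} (h₁ : S.IsMinimalRegion M₁) (h₂ : S.IsMinimalRegion M₂) (hne : M₁ ≠ M₂)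
    (hc : ∀ v, (v, (0 : ℝ)) ∈ C.box → S.proj (C.q (v, 0)) ∈ closure M₁ ∩ closure M₂) :
    ∃ v, (v, (0 : ℝ)) ∈ C.box ∧ S.proj (C.q (v, 0)) ∉ S.overlaps ∧
      ∃ x ∈ S.dom, x ≠ C.q (v, 0) ∧ S.proj x = S.proj (C.q (v, 0)) := by
  have hδ := C.δ_pos
  have hu₀ : (C.u₀, (0 : ℝ)) ∈ C.box :=
    ⟨⟨by linarith, by linarith⟩, ⟨by linarith, hδ⟩⟩
  obtain ⟨u, -, hu, huo⟩ := exists_notMem_overlaps hS hu₀ (P := fun _ => True) (by simp)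
  by_cases huniq : ∀ x ∈ S.dom, S.proj x = S.proj (C.q (u, 0)) → x = C.q (u, 0)
  · obtain ⟨r, hb, -⟩ := exists_subBox hu (P := fun _ => True) (by simp)
    have hr := hb.1
    have hbox : (u, -r) ∈ C.box := hb.mem ⟨by linarith, by linarith⟩ ⟨le_rfl, by linarith⟩
    rcases lt_trichotomy (C.h (u, -r)) (C.h (u, 0)) with h | h | h
    · exact hb.exists_other_preimage_aux hS h huniq h₁ h₂ hne (hc u hu).1 (hc u hu).2
    · refine absurd (huniq _ (q_mem_dom hS hbox (by simpa using hr.le)) ?_)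
        (q_ne hbox hu (by simpa using hr) rfl)
      rw [proj_q hbox, proj_q hu, h]
    -- If the chart leads up instead of down, reversing the second canvas coordinate reduces to the
    -- other case.
    · exact SubBox.exists_other_preimage_aux (C := C.flip) hS (u := u) (r := r) hb
        (neg_lt_neg h) huniq h₁ h₂ hne (hc u hu).1 (hc u hu).2
  · push Not at huniq
    obtain ⟨x, hx, hxp, hxne⟩ := huniq
    exact ⟨u, hu, huo, x, hx, hxne, hxp⟩

end BoundaryChart
-- Visible boundary lines
lemma oppositeOrientation_symm {M₁ M₂ : Set Plane} (h : S.OppositeOrientation M₁ M₂) :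
    S.OppositeOrientation M₂ M₁ :=
  h.symm.imp And.symm And.symm

lemma oppositeOrientation_of_facing (hcontour : S.ContoursDrawn) (hS : S.SketchAssumption)
    {M₁ M₂ : Set Plane} (h₁ : S.IsMinimalRegion M₁) (h₂ : S.IsMinimalRegion M₂) {x : Plane}
    (hw₁ : ∃ w ∈ S.visiblePart M₁, S.facing w * S.facing x < 0)
    (hw₂ : ∃ w ∈ S.visiblePart M₂, 0 < S.facing w * S.facing x) :
    S.OppositeOrientation M₁ M₂ := by
  obtain ⟨v, hv, hvx⟩ := hw₁
  obtain ⟨w, hw, hwx⟩ := hw₂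
  rcases mul_neg_iff.1 hvx with ⟨hv0, hx⟩ | ⟨hv0, hx⟩
  · exact Or.inl ⟨h₁.visibleFront hcontour hS hv hv0,
      h₂.visibleBack hcontour hS hw (neg_of_mul_pos_left hwx hx.le)⟩
  · exact Or.inr ⟨h₁.visibleBack hcontour hS hv hv0,
      h₂.visibleFront hcontour hS hw (pos_of_mul_pos_left hwx hx.le)⟩

namespace BoundaryChart

variable {C : BoundaryChart S}

/-- The level `c` separates the sheet of `x`, behind, from the chart sheet, in front. The sheet of
`x` covers both sides of the line, the chart sheet only the lower one. -/
lemma SubBox.oppositeOrientation (hcontour : S.ContoursDrawn) (hS : S.SketchAssumption)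
    {u r : ℝ} (hb : C.SubBox u r) (hlt : C.h (u, -r) < C.h (u, 0))
    {x : Plane} (hx : x ∈ interior S.dom) (hxf : S.facing x ≠ 0)
    (hxp : S.proj x = S.proj (C.q (u, 0)))
    (huniq : ∀ y ∈ S.dom, S.proj y = S.proj (C.q (u, 0)) → y = x ∨ y = C.q (u, 0))
    {c : ℝ} (hxc : height (S.f x) < c)
    (hqc : ∀ z ∈ Icc (u - r) (u + r) ×ˢ Icc (-r) r, c < height (S.f (C.q z)))
    {M₁ M₂ : Set Plane} (h₁ : S.IsMinimalRegion M₁) (h₂ : S.IsMinimalRegion M₂) (hne : M₁ ≠ M₂)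
    (hc₁ : S.proj (C.q (u, 0)) ∈ closure M₁) (hc₂ : S.proj (C.q (u, 0)) ∈ closure M₂) :
    S.OppositeOrientation M₁ M₂ := by
  have hr := hb.1
  let Φ : Plane → Prop := fun y =>
    y ∈ interior S.dom ∧ 0 < S.facing y * S.facing x ∧ height (S.f y) < c
  have hΦ : ∀ᶠ y in 𝓝 x, Φ y :=
    (isOpen_interior.eventually_mem hx).and
      (((S.continuous_facing.mul continuous_const).continuousAt.eventually_const_lt
        (mul_self_pos.2 hxf)).and (S.continuous_height.continuousAt.eventually_lt_const hxc))
  have hnear : ∀ᶠ p in 𝓝 (S.proj (C.q (u, 0))), ∀ y ∈ S.dom, S.proj y = p →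
      Φ y ∨ ∃ z ∈ Ioo (u - r) (u + r) ×ˢ Ioo (-r) r, C.q z = y :=
    hS.isCompact_dom.eventually_forall_preimage S.continuous_proj fun y hy hyp => by
      rcases huniq y hy hyp with rfl | rfl
      · exact hΦ.mono fun _ => Or.inl
      · exact Filter.mem_of_superset hb.image_mem_nhds fun y hy => Or.inr hy
  have hsheet : ∀ᶠ p in 𝓝 (S.proj (C.q (u, 0))), ∃ y, S.proj y = p ∧ Φ y := by
    rw [← hxp]
    exact eventually_exists_preimage hxf hΦ
  -- The sheet of `x` also passes behind the boundary point with the same first canvas coordinate as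
  -- `p`.
  have hsheet' : ∀ᶠ p in 𝓝 (S.proj (C.q (u, 0))),
      ∃ y, S.proj y = S.proj (C.q ((C.A p).1, 0)) ∧ Φ y := by
    have hA := A_proj_q_zero hb.center
    have hcA : ContinuousAt (fun p => ((C.A p).1, (0 : ℝ))) (S.proj (C.q (u, 0))) := by fun_prop
    have hcq : Tendsto (fun p => S.proj (C.q ((C.A p).1, 0))) (𝓝 (S.proj (C.q (u, 0))))
        (𝓝 (S.proj (C.q (u, 0)))) := by
      have h1 : ContinuousAt (fun z => S.proj (C.q z)) ((C.A (S.proj (C.q (u, 0)))).1, 0) := by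
        rw [hA]
        exact S.continuous_proj.continuousAt.comp (C.continuousAt _ hb.center)
      have h2 := ContinuousAt.comp (g := fun z => S.proj (C.q z))
        (f := fun p => ((C.A p).1, (0 : ℝ))) h1 hcA
      simpa only [ContinuousAt, Function.comp_def, hA] using h2
    exact hcq.eventually hsheet
  have hbdry : ∀ᶠ p in 𝓝 (S.proj (C.q (u, 0))), ∀ y ∈ S.bdry, S.proj y = p →
      ∃ z ∈ Ioo (u - r) (u + r) ×ˢ Ioo (-r) r, C.q z = y :=
    hnear.mono fun p hp y hy hyp => (hp y (hS.bdry_subset hy) hyp).resolve_left fun h => hy.2 h.1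
  have harea : ∀ᶠ p in 𝓝 (S.proj (C.q (u, 0))), p ∈ S.area :=
    hsheet.mono fun p ⟨y, hy, hyΦ⟩ => ⟨y, interior_subset hyΦ.1, hy⟩
  have hbelow := hb.eventually_preimage_below hlt
  -- Since the sheet of `x` covers a full neighbourhood, the strip argument works on both sides: at
  -- least one region lies above the graph, and, by the flipped chart, at least one below.
  have hd₁ := hb.eventually_above hS hbdry (harea.mono fun p hp _ => hp) h₁ h₂ hne
  have hd₂ := SubBox.eventually_above (C := C.flip) (u := u) (r := r) hS hb hbdry
    (harea.mono fun p hp _ => hp) h₁ h₂ hne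
  simp only [flip_h, flip_A_snd, flip_A_fst, neg_lt_neg_iff] at hd₂
  have habove_sign : ∀ M, S.IsMinimalRegion M → S.proj (C.q (u, 0)) ∈ closure M →
      (∀ᶠ p in 𝓝 (S.proj (C.q (u, 0))), p ∈ M → C.h ((C.A p).1, 0) < (C.A p).2) →
      ∃ w ∈ S.visiblePart M, 0 < S.facing w * S.facing x := by
    intro M hM hcl hev
    obtain ⟨m, ⟨hm1, hm2, hm3, hm4⟩, hmM⟩ :=
      mem_closure_iff_nhds.1 hcl _ (hev.and (hnear.and (hsheet'.and hbelow)))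
    obtain ⟨w, hw, rfl⟩ := hM.exists_visiblePart hS hmM
    refine ⟨w, hw, ?_⟩
    rcases hm2 w hw.1 rfl with h | ⟨⟨v, s⟩, ⟨hv, hs⟩, rfl⟩
    · exact h.2.1
    · exfalso
      have hv' := Ioo_subset_Icc_self hv
      have hvs : (v, s) ∈ C.box := hb.mem hv' (Ioo_subset_Icc_self hs)
      have hab := hm1 hmM
      have hbe := hm4.2.1
      rw [A_proj_q_zero hvs] at hab hbe hm3
      dsimp only at hab hbe hm3 hv hs
      have hs0 : s < 0 := (nonpos_of_q_mem_dom hvs hw.1).lt_of_ne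
        (by rintro rfl; exact lt_irrefl _ hab)
      -- A chart point above the graph would give a third point over the boundary point, besides the
      -- boundary itself and the sheet of `x`.
      obtain ⟨s', hs', he⟩ := hb.exists_second_preimage hv' le_rfl hs.1.le hs0 hbe hab
      obtain ⟨y, hy, hyΦ⟩ := hm3
      have hs'0 : s' < 0 := by linarith [hs'.2]
      have hs'I : s' ∈ Icc (-r) r := ⟨hs'.1, by linarith⟩
      have h0I : (0 : ℝ) ∈ Icc (-r) r := ⟨by linarith, hr.le⟩
      have hs'b : (v, s') ∈ C.box := hb.mem hv' hs'I
      have h0b : (v, (0 : ℝ)) ∈ C.box := hb.mem hv' h0I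
      rcases hS.three_preimages (interior_subset hyΦ.1) (q_mem_dom hS hs'b hs'0.le)
        (q_mem_dom hS h0b le_rfl) (hy.trans he.symm) hy with h | h | h
      · have := hqc (v, s') ⟨hv', hs'I⟩
        rw [← h] at this
        exact lt_asymm this hyΦ.2.2
      · have := hqc (v, 0) ⟨hv', h0I⟩
        rw [← h] at this
        exact lt_asymm this hyΦ.2.2
      · exact q_ne hs'b h0b hs'0 rfl h
  have hbelow_sign : ∀ M, S.IsMinimalRegion M → S.proj (C.q (u, 0)) ∈ closure M →
      (∀ᶠ p in 𝓝 (S.proj (C.q (u, 0))), p ∈ M → (C.A p).2 < C.h ((C.A p).1, 0)) →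
      ∃ w ∈ S.visiblePart M, S.facing w * S.facing x < 0 := by
    intro M hM hcl hev
    obtain ⟨m, ⟨hm1, hm2, hm3⟩, hmM⟩ :=
      mem_closure_iff_nhds.1 hcl _ (hev.and (hsheet.and hbelow))
    obtain ⟨s, hs, he⟩ := hm3.2.2 (hm1 hmM)
    obtain ⟨y, hy, hyΦ⟩ := hm2
    have hv := Ioo_subset_Icc_self hm3.1
    have hsI : s ∈ Icc (-r) r := ⟨hs.1.le, by linarith [hs.2]⟩
    have hbs : ((C.A m).1, s) ∈ C.box := hb.mem hv hsI
    set w := C.q ((C.A m).1, s) with hw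
    have hwD : w ∈ S.dom := q_mem_dom hS hbs hs.2.le
    have hwc : c < height (S.f w) := hqc _ ⟨hv, hsI⟩
    have hyD := interior_subset hyΦ.1
    have hyw : y ≠ w := by
      intro h
      rw [← h] at hwc
      exact lt_asymm hwc hyΦ.2.2
    have hvis : S.Visible w := by
      intro z hz hzw
      rcases hS.three_preimages hz hwD hyD hzw (hzw.trans (he.trans hy.symm)) with h | h | h
      · rw [h]
      · rw [h]; exact (hyΦ.2.2.trans hwc).le
      · exact absurd h.symm hyw
    refine ⟨w, ⟨hwD, he ▸ hmM, hvis⟩, ?_⟩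
    -- Below the graph both sheets are present: the chart sheet is visible and shows the side
    -- opposite to that of `x`.
    have hop := hM.opposite_facing hcontour hS hwD hyD (he.symm ▸ hmM) (hy.trans he.symm) hyw
    have hsame := hyΦ.2.1
    rcases mul_neg_iff.1 hop with ⟨h1, h2⟩ | ⟨h1, h2⟩
    · exact mul_neg_of_pos_of_neg h1 (neg_of_mul_pos_right hsame h2.le)
    · exact mul_neg_of_neg_of_pos h1 (pos_of_mul_pos_right hsame h2.le)
  have hcontra : ∀ M, S.proj (C.q (u, 0)) ∈ closure M →
      (∀ᶠ p in 𝓝 (S.proj (C.q (u, 0))), p ∈ M → C.h ((C.A p).1, 0) < (C.A p).2) →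
      ¬ ∀ᶠ p in 𝓝 (S.proj (C.q (u, 0))), p ∈ M → (C.A p).2 < C.h ((C.A p).1, 0) := by
    intro M hcl ha hb
    obtain ⟨m, ⟨hm1, hm2⟩, hmM⟩ := mem_closure_iff_nhds.1 hcl _ (ha.and hb)
    exact lt_asymm (hm1 hmM) (hm2 hmM)
  rcases hd₁ with ha | ha <;> rcases hd₂ with hb' | hb'
  · exact absurd hb' (hcontra M₁ hc₁ ha)
  · exact oppositeOrientation_symm (oppositeOrientation_of_facing hcontour hS h₂ h₁
      (hbelow_sign M₂ h₂ hc₂ hb') (habove_sign M₁ h₁ hc₁ ha))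
  · exact oppositeOrientation_of_facing hcontour hS h₁ h₂
      (hbelow_sign M₁ h₁ hc₁ hb') (habove_sign M₂ h₂ hc₂ ha)
  · exact absurd hb' (hcontra M₂ hc₂ ha)

lemma oppositeOrientation (hcontour : S.ContoursDrawn) (hS : S.SketchAssumption)
    {M₁ M₂ : Set Plane} (h₁ : S.IsMinimalRegion M₁) (h₂ : S.IsMinimalRegion M₂) (hne : M₁ ≠ M₂)
    (hc : ∀ v, (v, (0 : ℝ)) ∈ C.box → S.proj (C.q (v, 0)) ∈ closure M₁ ∩ closure M₂)
    (hv : ∀ v, (v, (0 : ℝ)) ∈ C.box → S.Visible (C.q (v, 0))) :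
    S.OppositeOrientation M₁ M₂ := by
  obtain ⟨u, hu, huo, x, hx, hxne, hxp⟩ := exists_other_preimage hS h₁ h₂ hne hc
  have hqD := q_mem_dom hS hu le_rfl
  obtain ⟨hxi, hxf⟩ := regular_of_notMem_overlaps (C.mem_bdry _ hu rfl) huo hx hxp hxne
  obtain ⟨c, hxc, hcq⟩ := exists_between (hS.height_lt hqD hx (hv u hu) hxp hxne)
  obtain ⟨r, hb, hr⟩ := exists_subBox hu ((S.continuous_height.continuousAt.comp
    (C.continuousAt _ hu)).eventually_const_lt hcq)
  have huniq : ∀ y ∈ S.dom, S.proj y = S.proj (C.q (u, 0)) → y = x ∨ y = C.q (u, 0) := by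
    intro y hy hyp
    rcases hS.three_preimages hy hx hqD (hyp.trans hxp.symm) hyp with h | h | h
    exacts [Or.inl h, Or.inr h, absurd h hxne]
  have hr0 := hb.1
  have hmI : (u, -r) ∈ Icc (u - r) (u + r) ×ˢ Icc (-r) r :=
    ⟨⟨by linarith, by linarith⟩, ⟨le_rfl, by linarith⟩⟩
  have hbox : (u, -r) ∈ C.box := hb.mem hmI.1 hmI.2
  rcases lt_trichotomy (C.h (u, -r)) (C.h (u, 0)) with h | h | h
  · exact hb.oppositeOrientation hcontour hS h hxi hxf hxp huniq hxc hr h₁ h₂ hne (hc u hu).1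
      (hc u hu).2
  -- The chart point `(u, -r)` would lie over the boundary point, but it is above level `c`, unlike
  -- `x`, and is not on the boundary.
  · exfalso
    rcases huniq _ (q_mem_dom hS hbox (by simpa using hr0.le))
      (by rw [proj_q hbox, proj_q hu, h]) with h' | h'
    · have := hr _ hmI
      simp only [Function.comp_apply, h'] at this
      exact lt_asymm this hxc
    · exact q_ne hbox hu (by simpa using hr0) rfl h'
  · exact SubBox.oppositeOrientation (C := C.flip) (u := u) (r := r) hcontour hS hb
      (neg_lt_neg h) hxi hxf hxp huniq hxc hr h₁ h₂ hne (hc u hu).1 (hc u hu).2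

end BoundaryChart
-- Construction of boundary charts
/-- Near a point of the boundary that is not a corner, the domain is a sublevel set of a regular
function. -/
lemma SketchAssumption.exists_definingFunction (hS : S.SketchAssumption) {W : Set Plane}
    (hW : IsOpen W) (hne : (W ∩ S.bdry).Nonempty) :
    ∃ (N : Set Plane) (ρ : Plane → ℝ), IsOpen N ∧ N ⊆ W ∧ (N ∩ S.bdry).Nonempty ∧
      ContDiff ℝ 1 ρ ∧ (∀ x ∈ N, fderiv ℝ ρ x ≠ 0) ∧ (∀ x ∈ N, 0 < ρ x → x ∉ S.dom) ∧
      (∀ x ∈ N, ρ x = 0 → x ∈ S.bdry) ∧ (∀ x ∈ N, ρ x < 0 → x ∈ interior S.dom) := by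
  obtain ⟨corners, hfin, hcor⟩ := S.piecewise_boundary
  obtain ⟨b, ⟨hbW, hb⟩, hbc⟩ : ∃ b ∈ W ∩ S.bdry, b ∉ corners := by
    obtain ⟨b, hbW, hb⟩ := hne
    by_cases hbc : b ∈ corners
    · have hcl : IsOpen (corners \ {b})ᶜ := (hfin.subset sdiff_subset).isClosed.isOpen_compl
      obtain ⟨b', ⟨⟨h1, h2⟩, h3⟩, hne⟩ := hS.exists_mem_bdry_ne hb
        (inter_mem (hW.mem_nhds hbW) (hcl.mem_nhds fun h => h.2 rfl))
      exact ⟨b', ⟨h1, h3⟩, fun h => h2 ⟨h, hne⟩⟩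
    · exact ⟨b, ⟨hbW, hb⟩, hbc⟩
  obtain ⟨N, ρ, hN, hbN, hρ, hdρ, hdom⟩ := hcor b ⟨hb, hbc⟩
  have hmem : ∀ x ∈ N, (x ∈ S.dom ↔ ρ x ≤ 0) := fun x hx => by
    have : x ∈ S.dom ∩ N ↔ x ∈ {x ∈ N | ρ x ≤ 0} := by rw [hdom]
    simpa [hx] using this
  have hreg : IsOpen {x | fderiv ℝ ρ x ≠ 0} :=
    isOpen_ne_fun (hρ.continuous_fderiv (by norm_num)) continuous_const
  refine ⟨(W ∩ N) ∩ {x | fderiv ℝ ρ x ≠ 0}, ρ, (hW.inter hN).inter hreg,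
    fun x hx => hx.1.1, ⟨b, ⟨⟨hbW, hbN⟩, hdρ⟩, hb⟩, hρ, fun x hx => hx.2,
    fun x hx h hx' => ((hmem x hx.1.2).1 hx').not_gt h, fun x hx h => ?_, fun x hx h => ?_⟩
  · refine ⟨subset_closure ((hmem x hx.1.2).2 h.le), fun hi => hx.2 ?_⟩
    -- At an interior point of `D` with `ρ x = 0`, `ρ` would have a local maximum.
    refine IsLocalMax.fderiv_eq_zero ?_
    filter_upwards [mem_interior_iff_mem_nhds.1 hi, hN.mem_nhds hx.1.2] with y hy hyN
    rw [h]
    exact (hmem y hyN).1 hy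
  · rw [mem_interior_iff_mem_nhds]
    filter_upwards [hN.mem_nhds hx.1.2, hρ.continuous.continuousAt.eventually_lt_const h] with
      y hyN hy
    exact (hmem y hyN).2 hy.le

/-- The projection is not constant along the boundary. -/
lemma SketchAssumption.exists_tangent (hS : S.SketchAssumption) {N : Set Plane} {ρ : Plane → ℝ}
    (hN : IsOpen N) (hne : (N ∩ S.bdry).Nonempty) (hρ : ContDiff ℝ 1 ρ)
    (hdρ : ∀ x ∈ N, fderiv ℝ ρ x ≠ 0) (hpos : ∀ x ∈ N, 0 < ρ x → x ∉ S.dom)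
    (hzero : ∀ x ∈ N, ρ x = 0 → x ∈ S.bdry) (hneg : ∀ x ∈ N, ρ x < 0 → x ∈ interior S.dom) :
    ∃ b ∈ N ∩ S.bdry, ∃ t, fderiv ℝ ρ b t = 0 ∧ fderiv ℝ S.proj b t ≠ 0 := by
  by_contra! hcon
  obtain ⟨b₁, hb₁N, hb₁⟩ := hne
  have hρ0 : ∀ x ∈ N, x ∈ S.bdry → ρ x = 0 := fun x hx hxb => by
    rcases lt_trichotomy (ρ x) 0 with h | h | h
    · exact absurd (hneg x hx h) hxb.2
    · exact h
    · exact absurd (hS.bdry_subset hxb) (hpos x hx h)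
  obtain ⟨j, k, hjk, hj⟩ : ∃ j k : Fin 2, j ≠ k ∧
      fderiv ℝ ρ b₁ (EuclideanSpace.single j 1) ≠ 0 := by
    by_contra! h
    refine hdρ b₁ hb₁N (ContinuousLinearMap.ext fun v => ?_)
    rw [fderiv_apply_eq_coord _ v (zero_ne_one), h 0 1 (by simp), h 1 0 (by simp)]
    simp
  obtain ⟨N', hN', hcurve⟩ := exists_level_curve hρ.contDiffAt hjk hj (hN.mem_nhds hb₁N)
  obtain ⟨b₂, ⟨⟨hb₂N', hb₂N⟩, hb₂⟩, hne⟩ := hS.exists_mem_bdry_ne hb₁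
    (inter_mem hN' (hN.mem_nhds hb₁N))
  have hb₁0 := hρ0 b₁ hb₁N hb₁
  obtain ⟨a, b, h₁, h₂, c, hc₁, hc₂, hc⟩ := hcurve b₁ (mem_of_mem_nhds hN') b₂ hb₂N'
    (by rw [hb₁0, hρ0 b₂ hb₂N hb₂])
  have hbdry : ∀ v ∈ Ioo a b, c v ∈ S.bdry := fun v hv =>
    hzero _ (hc v hv).1 ((hc v hv).2.1.trans hb₁0)
  have hder : ∀ v ∈ Ioo a b, HasDerivAt (fun v => S.proj (c v)) 0 v := by
    intro v hv
    have h1 := (hc v hv).2.2.2.hasDerivAt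
    have h2 := ((hρ.differentiable (by norm_num)).differentiableAt (x :=
      c v)).hasFDerivAt.comp_hasDerivAt v h1
    have h3 : fderiv ℝ ρ (c v) (deriv c v) = 0 :=
      h2.unique ((hasDerivAt_const v (ρ b₁)).congr_of_eventuallyEq (by
        filter_upwards [Ioo_mem_nhds hv.1 hv.2] with w hw using (hc w hw).2.1))
    have h4 := (S.hasFDerivAt_proj (c v)).comp_hasDerivAt v h1
    rw [hcon _ ⟨(hc v hv).1, hbdry v hv⟩ _ h3] at h4
    exact h4
  -- If the differential of `g` killed all tangents, `g` would be constant on a boundary arc, and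
  -- three points of this arc would violate the two-point assumption.
  have hconst : ∀ v ∈ Ioo a b, ∀ w ∈ Ioo a b, S.proj (c v) = S.proj (c w) := fun v hv w hw =>
    isOpen_Ioo.is_const_of_deriv_eq_zero (convex_Ioo a b).isPreconnected
      (fun x hx => (hder x hx).differentiableAt.differentiableWithinAt)
      (fun x hx => (hder x hx).deriv) hv hw
  have hab : a < b := h₁.1.trans h₁.2
  have m1 : (3 * a + b) / 4 ∈ Ioo a b := ⟨by linarith, by linarith⟩
  have m2 : (a + b) / 2 ∈ Ioo a b := ⟨by linarith, by linarith⟩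
  have m3 : (a + 3 * b) / 4 ∈ Ioo a b := ⟨by linarith, by linarith⟩
  have hinj : ∀ v ∈ Ioo a b, ∀ w ∈ Ioo a b, c v = c w → v = w := fun v hv w hw h => by
    rw [← (hc v hv).2.2.1, ← (hc w hw).2.2.1, h]
  rcases hS.three_preimages (hS.bdry_subset (hbdry _ m1)) (hS.bdry_subset (hbdry _ m2))
    (hS.bdry_subset (hbdry _ m3)) (hconst _ m1 _ m2) (hconst _ m1 _ m3) with h | h | h
  · linarith [hinj _ m1 _ m2 h]
  · linarith [hinj _ m1 _ m3 h]
  · linarith [hinj _ m2 _ m3 h]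

lemma SketchAssumption.exists_boundaryChart (hS : S.SketchAssumption) {W : Set Plane}
    (hW : IsOpen W) (hne : (W ∩ S.bdry).Nonempty) :
    ∃ C : BoundaryChart S, ∀ z ∈ C.box, C.q z ∈ W := by
  obtain ⟨N, ρ, hN, hNW, hNb, hρ, hdρ, hpos, hzero, hneg⟩ := hS.exists_definingFunction hW hne
  obtain ⟨b, ⟨hbN, hb⟩, t, ht, htg⟩ := hS.exists_tangent hN hNb hρ hdρ hpos hzero hneg
  have hb0 : ρ b = 0 := by
    rcases lt_trichotomy (ρ b) 0 with h | h | h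
    · exact absurd (hneg b hbN h) hb.2
    · exact h
    · exact absurd (hS.bdry_subset hb) (hpos b hbN h)
  obtain ⟨i, hi⟩ : ∃ i, fderiv ℝ S.proj b t i ≠ 0 := by
    by_contra! h
    exact htg (by ext i; exact h i)
  obtain ⟨l, hil⟩ : ∃ l, i ≠ l := ⟨i + 1, by fin_cases i <;> simp⟩
  have hF : ContDiff ℝ 1 fun x => S.proj x i :=
    (EuclideanSpace.proj (𝕜 := ℝ) i).contDiff.comp (S.contDiff_proj.of_le (by norm_num))
  -- The chart is the inverse of `(g i, ρ)`: the second coordinate tells the side of the boundary,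
  -- and the tangent `t` makes the first one regular along it.
  have hG : ContDiffAt ℝ 1 (fun x => (S.proj x i, ρ x)) b := (hF.prodMk hρ).contDiffAt
  have hdG : fderiv ℝ (fun x => (S.proj x i, ρ x)) b = _ :=
    ((hasFDerivAt_proj_apply (S := S) i b).prodMk
      ((hρ.differentiable (by norm_num)).differentiableAt (x := b)).hasFDerivAt).fderiv
  have hinj : Function.Injective (fderiv ℝ (fun x => (S.proj x i, ρ x)) b) := by
    rw [hdG, injective_iff_map_eq_zero]
    intro v hv
    obtain ⟨h1, h2⟩ := Prod.mk.inj hv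
    have h1 : fderiv ℝ S.proj b v i = 0 := h1
    have h2 : fderiv ℝ ρ b v = 0 := h2
    -- Both vectors lie in the kernel of the nonzero differential of `ρ`, hence are parallel.
    have hdet : v 0 * t 1 = v 1 * t 0 := by
      by_contra hdet
      rw [fderiv_apply_eq_coord _ _ zero_ne_one] at h2 ht
      refine hdρ b hbN (ContinuousLinearMap.ext fun w => ?_)
      have e0 : (v 0 * t 1 - v 1 * t 0) * fderiv ℝ ρ b (EuclideanSpace.single 0 1) = 0 := by
        linear_combination t 1 * h2 - v 1 * ht
      have e1 : (v 0 * t 1 - v 1 * t 0) * fderiv ℝ ρ b (EuclideanSpace.single 1 1) = 0 := by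
        linear_combination v 0 * ht - t 0 * h2
      rw [fderiv_apply_eq_coord _ w zero_ne_one,
        (mul_eq_zero.1 e0).resolve_left (sub_ne_zero.2 hdet),
        (mul_eq_zero.1 e1).resolve_left (sub_ne_zero.2 hdet)]
      simp
    rw [S.fderiv_proj_apply] at h1 hi
    ext m
    refine (mul_eq_zero.1 (?_ : v m * (t 0 * S.jac i 0 b + t 1 * S.jac i 1 b) = 0)).resolve_right hi
    fin_cases m
    · show v 0 * _ = 0
      linear_combination t 0 * h1 + S.jac i 1 b * hdet
    · show v 1 * _ = 0
      linear_combination t 1 * h1 - S.jac i 0 b * hdet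
  obtain ⟨δ, hδ, q, hq, -⟩ := exists_local_inverse hG hinj (hN.mem_nhds hbN)
  simp only [hb0, ← ball_prod_same, Real.ball_eq_Ioo, zero_sub, zero_add] at hq
  -- The canvas coordinates are ordered so that the coordinate `i` comes first.
  let A : Plane ≃L[ℝ] ℝ × ℝ := (LinearMap.linearEquivOfInjective
    ((EuclideanSpace.proj (𝕜 := ℝ) i).prod (EuclideanSpace.proj (𝕜 := ℝ) l)).toLinearMap (by
      rw [injective_iff_map_eq_zero]
      intro v hv
      obtain ⟨h1, h2⟩ := Prod.mk.inj hv
      have h1 : v i = 0 := h1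
      have h2 : v l = 0 := h2
      ext m
      fin_cases i <;> fin_cases l <;> fin_cases m <;>
        first | exact absurd rfl hil | exact h1 | exact h2) (by simp)).toContinuousLinearEquiv
  have hA : ∀ p, (A p).1 = p i := fun p => rfl
  refine ⟨⟨A, q, S.proj b i, δ, hδ, fun z hz => (hq z hz).2.2.1.continuousAt, fun z hz O hO => ?_,
    fun z hz => ?_, fun z hz h => ?_, fun z hz h => ?_, fun z hz h => ?_⟩, fun z hz => ?_⟩
  · obtain ⟨-, h2, -, h4, h5⟩ := hq z hz
    have hO' : ∀ᶠ x in 𝓝 (q z), (S.proj x i, ρ x) ∈ O :=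
      h4.eventually (show O ∈ 𝓝 (S.proj (q z) i, ρ (q z)) by rw [h2]; exact hO)
    filter_upwards [hO', h5] with x hx hx'
    exact ⟨_, hx, hx'⟩
  · rw [hA]
    exact congrArg Prod.fst (hq z hz).2.1
  · exact hneg _ (hq z hz).1 (lt_of_eq_of_lt (congrArg Prod.snd (hq z hz).2.1) h)
  · exact hzero _ (hq z hz).1 ((congrArg Prod.snd (hq z hz).2.1).trans h)
  · exact hpos _ (hq z hz).1 (lt_of_lt_of_eq h (congrArg Prod.snd (hq z hz).2.1).symm)
  · exact hNW (hq z hz).1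

end Surface

theorem proposition1 (S : Surface) (hcontour : S.ContoursDrawn) (hS : S.SketchAssumption)
    (M₁ M₂ : Set Plane) (h₁ : S.IsMinimalRegion M₁) (h₂ : S.IsMinimalRegion M₂) (hne : M₁ ≠ M₂) :
    (S.ShareLine S.visibleBdry M₁ M₂ → S.OppositeOrientation M₁ M₂) ∧
    (S.ShareLine S.occludedBdry M₁ M₂ → S.SameOrientation M₁ M₂) := by
  refine ⟨?_, Surface.sameOrientation_of_shareLine_occluded hcontour hS h₁ h₂⟩
  rintro ⟨W, hW, hWne, hvis, hfr⟩
  obtain ⟨C, hC⟩ := hS.exists_boundaryChart hW hWne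
  have hmem : ∀ v, (v, (0 : ℝ)) ∈ C.box → C.q (v, 0) ∈ W ∩ S.bdry := fun v hv =>
    ⟨hC _ hv, C.mem_bdry _ hv rfl⟩
  refine C.oppositeOrientation hcontour hS h₁ h₂ hne (fun v hv => ?_)
    fun v hv => (hvis (hmem v hv)).2
  have := hfr (mem_image_of_mem _ (hmem v hv))
  exact ⟨this.1.1, this.2.1⟩
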